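/- Let $\mathbb K$ be a field of characteristic $2$. A Lie superalgebra over $\mathbb K$ is a $\mathbb Z/2$-graded space $L=L_{\bar 0}\oplus L_{\bar 1}$ with a bilinear bracket such that $L_{\bar 0}$ is a Lie algebra, $L_{\bar 1}$ is an $L_{\bar 0}$-module made two-sided by symmetry, together with a map $s:L_{\bar 1}\to L_{\bar 0}$ (the squaring) with $s(\lambda x)=\lambda^2s(x)$, $[x,y]=s(x+y)-s(x)-s(y)$ for $x,y\in L_{\bar 1}$, and $[s(x),y]=[x,[x,y]]$ for $x\in L_{\bar 1}$, $y\in L$. A Poisson superalgebra $(P,\{-,-\},s)$ is a Lie superalgebra with an associative commutative graded product (not necessarily unital) with $x^2=0$ for $x\in P_{\bar 1}$, $\{xy,z\}=x\{y,z\}+\{x,z\}y$, and $s(xy)=x^2s(y)+xy\{x,y\}$ for $x\in P_{\bar 0}$, $y\in P_{\bar 1}$. The same definitions are used over $\mathbb K[[t]]$. An even Poisson $2$-cochain is a pair $(\varphi,\omega)$, where $\varphi:P\times P\to P$ is bilinear, alternating, grading-preserving and satisfies $\varphi(xy,z)=x\varphi(y,z)+y\varphi(x,z)$, and $\omega:P_{\bar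 1}\to P_{\bar 0}$ satisfies $\omega(\lambda x)=\lambda^2\omega(x)$, $\omega(x+y)=\omega(x)+\omega(y)+\varphi(x,y)$, and $\omega(xy)=y^2\omega(x)+xy\,\varphi(x,y)$ for $x\in P_{\bar 1}$, $y\in P_{\bar 0}$. An even Poisson $3$-cochain is a pair $(\varphi,\omega)$, where $\varphi:P^3\to P$ is trilinear, alternating, grading-preserving and a derivation of the product in its first (hence each) argument, and $\omega:P_{\bar 1}\times P\to P$ is linear in the second argument, sends $P_{\bar 1}\times P_{i}$ to $P_{i}$, and satisfies $\omega(\lambda x,z)=\lambda^2\omega(x,z)$, $\omega(x+y,z)=\omega(x,z)+\omega(y,z)+\varphi(x,y,z)$, $\omega(xy,z)=y^2\omega(x,z)+xy\,\varphi(x,y,z)$ for $x\in P_{\bar 1}$, $y\in P_{\bar 0}$, and $\omega(x,zz')=z\,\omega(x,z')+z'\omega(x,z)$. The coboundary is $d^2_{\rm po}(\varphi,\omega)=(d^2_{\rm CE}\varphi,\delta^2\omega)$ with $$d^2_{\rm CE}\varphi(x,y,z)=\{x,\varphi(y,z)\}+\{y,\varphi(x,z)\}+\{z,\varphi(x,y)\}+\varphi(\{x,y\},z)+\varphi(\{x,z\},y)+\varphi(\{y,z\},x),$$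 $$\delta^2\omega(x,z)=\{x,\varphi(x,z)\}+\{z,\omega(x)\}+\varphi(s(x),z)+\varphi(\{x,z\},x).$$ For $k\ge 1$, a formal deformation of order $k$ of $(P,\{-,-\},s)$ is a Poisson superalgebra $(P_k[[t]],\mu_{(k)},\omega_{(k)})$ over $\mathbb K[[t]]$, where $P_k[[t]]=P[[t]]/\langle t^{k+1}\rangle$ carries the product and grading induced by those of $P$, and $$\mu_{(k)}(x,y)=\{x,y\}+\sum_{i=1}^k t^i\mu_i(x,y)\quad(x,y\in P),\qquad \omega_{(k)}(x)=s(x)+\sum_{i=1}^k t^i\omega_i(x)\quad(x\in P_{\bar 1}).$$ Let such a deformation of order $k\ge 1$ be given, and set $$\mathrm{obs}^{(1)}_{k+1}(x,y,z)=\sum_{i=1}^k\bigl(\mu_i(x,\mu_{k+1-i}(y,z))+\mu_i(y,\mu_{k+1-i}(z,x))+\mu_i(z,\mu_{k+1-i}(x,y))\bigr),\quad x,y,z\in P,$$ $$\mathrm{obs}^{(2)}_{k+1}(x,y)=\sum_{i=1}^k\bigl(\mu_i(y,\omega_{k+1-i}(x))+\mu_i(x,\mu_{k+1-i}(x,y))\bigr),\quad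 x\in P_{\bar 1},\ y\in P.$$ Then $(\mathrm{obs}^{(1)}_{k+1},\mathrm{obs}^{(2)}_{k+1})$ is an even Poisson $3$-cochain. Moreover, for every even Poisson $2$-cochain $(\mu_{k+1},\omega_{k+1})$, the maps $\mu_{(k+1)}=\mu_{(k)}+t^{k+1}\mu_{k+1}$ and $\omega_{(k+1)}=\omega_{(k)}+t^{k+1}\omega_{k+1}$ define a formal deformation of order $k+1$ of $(P,\{-,-\},s)$ if and only if $$\bigl(\mathrm{obs}^{(1)}_{k+1},\mathrm{obs}^{(2)}_{k+1}\bigr)=d^2_{\rm po}(\mu_{k+1},\omega_{k+1}).$$ -/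

import Mathlib

open scoped PowerSeries

/-!  Poisson superalgebras in characteristic 2.

The grading of a superspace `L` is a family `𝒜 : ZMod 2 → Submodule R L`, with `𝒜 0` the even part
and `𝒜 1` the odd part.  The definitions are over a commutative ring `R`, so that they apply both
to superalgebras over a field `K` and to superalgebras over `K⟦X⟧`; they are meant for rings of
characteristic 2. -/

/-- `(L, [-,-], s)` is a Lie superalgebra (characteristic 2) over `R`: the even part is a Lie
algebra, the odd part is a module over it, made two-sided by symmetry, and the squaring
`s : L_odd → L_even` is quadratic with polar form the bracket of odd elements, and satisfies
`[s x, y] = [x, [x, y]]`. -/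
structure IsLieSuperalgebra (R : Type*) {L : Type*} [CommRing R] [AddCommGroup L] [Module R L]
    (𝒜 : ZMod 2 → Submodule R L) (br : L → L → L) (s : 𝒜 1 → L) : Prop where
  isCompl : IsCompl (𝒜 0) (𝒜 1)
  linear_left : ∀ y, IsLinearMap R (fun x => br x y)
  linear_right : ∀ x, IsLinearMap R (fun y => br x y)
  bracket_mem : ∀ i j, ∀ x ∈ 𝒜 i, ∀ y ∈ 𝒜 j, br x y ∈ 𝒜 (i + j)
  /-- The even part is a Lie algebra. -/
  even_self : ∀ x ∈ 𝒜 0, br x x = 0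
  even_jacobi : ∀ x ∈ 𝒜 0, ∀ y ∈ 𝒜 0, ∀ z ∈ 𝒜 0,
    br x (br y z) + br y (br z x) + br z (br x y) = 0
  /-- The odd part is a module over the even part, two-sided by symmetry. -/
  odd_module : ∀ x ∈ 𝒜 0, ∀ y ∈ 𝒜 0, ∀ z ∈ 𝒜 1,
    br (br x y) z = br x (br y z) - br y (br x z)
  odd_symm : ∀ x ∈ 𝒜 0, ∀ y ∈ 𝒜 1, br y x = br x y
  /-- The squaring. -/
  sq_mem : ∀ x, s x ∈ 𝒜 0
  sq_smul : ∀ (c : R) (x : 𝒜 1), s (c • x) = c ^ 2 • s x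
  sq_polar : ∀ x y : 𝒜 1, br x y = s (x + y) - s x - s y
  sq_jacobi : ∀ (x : 𝒜 1) (y : L), br (s x) y = br x (br x y)

/-- `(P, ·, {-,-}, s)` is a Poisson superalgebra (characteristic 2) over `R`.  Associativity and
commutativity of the product (which need not have a unit) are part of `NonUnitalCommRing P`. -/
structure IsPoissonSuperalgebra (R : Type*) {P : Type*} [CommRing R] [NonUnitalCommRing P]
    [Module R P] [IsScalarTower R P P] [SMulCommClass R P P]
    (𝒜 : ZMod 2 → Submodule R P) (br : P → P → P) (s : 𝒜 1 → P) : Prop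
    extends IsLieSuperalgebra R 𝒜 br s where
  /-- The product makes `P` a supercommutative superalgebra. -/
  mul_mem : ∀ i j, ∀ x ∈ 𝒜 i, ∀ y ∈ 𝒜 j, x * y ∈ 𝒜 (i + j)
  mul_self_odd : ∀ x ∈ 𝒜 1, x * x = 0
  leibniz : ∀ x y z, br (x * y) z = x * br y z + br x z * y
  /-- `s (xy) = x² s(y) + xy {x, y}` for `x` even and `y` odd; here `w` is the product `xy`,
  seen as an element of the odd part. -/
  sq_mul : ∀ x ∈ 𝒜 0, ∀ y w : 𝒜 1, (w : P) = x * y →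
    s w = x * x * s y + x * y * br x y

section Cochains

variable {K P : Type*} [Field K] [NonUnitalCommRing P] [Module K P]

/-- `(φ, ω) ∈ XC²(P; P)`: a 2-cochain of Lie superalgebras in characteristic 2. -/
structure IsLieCochain₂ (𝒜 : ZMod 2 → Submodule K P) (φ : P → P → P) (ω : 𝒜 1 → P) : Prop where
  linear₁ : ∀ y, IsLinearMap K (fun x => φ x y)
  linear₂ : ∀ x, IsLinearMap K (fun y => φ x y)
  alternating : ∀ x, φ x x = 0
  smul : ∀ (c : K) (x : 𝒜 1), ω (c • x) = c ^ 2 • ω x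
  add : ∀ x y : 𝒜 1, ω (x + y) = ω x + ω y + φ x y

/-- `(φ, ω)` is an even Poisson 2-cochain: an element of `XC²_po(P)` of even degree. -/
structure IsEvenPoissonCochain₂ (𝒜 : ZMod 2 → Submodule K P) (φ : P → P → P) (ω : 𝒜 1 → P) :
    Prop extends IsLieCochain₂ 𝒜 φ ω where
  derivation : ∀ x y z, φ (x * y) z = x * φ y z + y * φ x z
  /-- `ω (xy) = y² ω(x) + xy φ(x, y)` for `x` odd and `y` even, with `w = xy`. -/
  mul : ∀ (x : 𝒜 1), ∀ y ∈ 𝒜 0, ∀ w : 𝒜 1, (w : P) = x * y →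
    ω w = y * y * ω x + x * y * φ x y
  even_fst : ∀ i j, ∀ x ∈ 𝒜 i, ∀ y ∈ 𝒜 j, φ x y ∈ 𝒜 (i + j)
  even_snd : ∀ x, ω x ∈ 𝒜 0

/-- `(φ, ω) ∈ XC³(P; P)`: a 3-cochain of Lie superalgebras in characteristic 2. -/
structure IsLieCochain₃ (𝒜 : ZMod 2 → Submodule K P) (φ : P → P → P → P) (ω : 𝒜 1 → P → P) :
    Prop where
  linear₁ : ∀ y z, IsLinearMap K (fun x => φ x y z)
  linear₂ : ∀ x z, IsLinearMap K (fun y => φ x y z)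
  linear₃ : ∀ x y, IsLinearMap K (fun z => φ x y z)
  alternating₁₂ : ∀ x z, φ x x z = 0
  alternating₁₃ : ∀ x y, φ x y x = 0
  alternating₂₃ : ∀ x y, φ x y y = 0
  smul : ∀ (c : K) (x : 𝒜 1) (z : P), ω (c • x) z = c ^ 2 • ω x z
  add : ∀ (x y : 𝒜 1) (z : P), ω (x + y) z = ω x z + ω y z + φ x y z
  linear : ∀ x, IsLinearMap K (ω x)

/-- `(φ, ω)` is an even Poisson 3-cochain: an element of `XC³_po(P)` of even degree.  The second
component has two odd slots filled by the same element, so it is even when it preserves the parity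
of its last argument. -/
structure IsEvenPoissonCochain₃ (𝒜 : ZMod 2 → Submodule K P) (φ : P → P → P → P)
    (ω : 𝒜 1 → P → P) : Prop extends IsLieCochain₃ 𝒜 φ ω where
  derivation : ∀ x y z v, φ (x * y) z v = x * φ y z v + y * φ x z v
  /-- `ω (xy, z) = y² ω(x, z) + xy φ(x, y, z)` for `x` odd and `y` even, with `w = xy`. -/
  mul : ∀ (x : 𝒜 1), ∀ y ∈ 𝒜 0, ∀ w : 𝒜 1, (w : P) = x * y → ∀ z,
    ω w z = y * y * ω x z + x * y * φ x y z
  mul_right : ∀ (x : 𝒜 1) (z z' : P), ω x (z * z') = z * ω x z' + z' * ω x z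
  even_fst : ∀ i j l, ∀ x ∈ 𝒜 i, ∀ y ∈ 𝒜 j, ∀ z ∈ 𝒜 l, φ x y z ∈ 𝒜 (i + j + l)
  even_snd : ∀ i, ∀ x : 𝒜 1, ∀ z ∈ 𝒜 i, ω x z ∈ 𝒜 i

/-- The coboundary `d²_po (φ, ω) = (d²_CE φ, δ² ω)` of a 2-cochain, with respect to the bracket
`br` and the squaring `s`, with the adjoint coefficients (there are no signs in characteristic
2). -/
def poissonD₂ {𝒜 : ZMod 2 → Submodule K P} (br : P → P → P) (s : 𝒜 1 → P)
    (φ : P → P → P) (ω : 𝒜 1 → P) : (P → P → P → P) × (𝒜 1 → P → P) :=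
  (fun x y z => br x (φ y z) + br y (φ x z) + br z (φ x y)
      + φ (br x y) z + φ (br x z) y + φ (br y z) x,
    fun x z => br x (φ x z) + br z (ω x) + φ (s x) z + φ (br x z) x)

/-- The obstruction `obs¹_{k+1}`. -/
def obs₁ (k : ℕ) (μ : ℕ → P → P → P) (x y z : P) : P :=
  ∑ i ∈ Finset.Icc 1 k, (μ i x (μ (k + 1 - i) y z) + μ i y (μ (k + 1 - i) z x)
    + μ i z (μ (k + 1 - i) x y))

/-- The obstruction `obs²_{k+1}`. -/
def obs₂ {𝒜 : ZMod 2 → Submodule K P} (k : ℕ) (μ : ℕ → P → P → P) (ω : ℕ → 𝒜 1 → P)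
    (x : 𝒜 1) (y : P) : P :=
  ∑ i ∈ Finset.Icc 1 k, (μ i y (ω (k + 1 - i) x) + μ i x (μ (k + 1 - i) x y))

end Cochains

/-- The truncated series `P_k[[t]] = P[[t]] / ⟨t^{k+1}⟩`: an element `∑_{i ≤ k} t^i x_i` is given
by its coefficients `x_0, …, x_k`. -/
def TruncatedSeries (k : ℕ) (P : Type*) : Type _ := Fin (k + 1) → P

namespace TruncatedSeries

variable {k : ℕ} {P : Type*}

instance instAddCommGroup [AddCommGroup P] : AddCommGroup (TruncatedSeries k P) :=
  inferInstanceAs (AddCommGroup (Fin (k + 1) → P))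

/-- The series `∑_{i ≤ k} t^i a_i`. -/
def mk (k : ℕ) (a : ℕ → P) : TruncatedSeries k P := fun i => a i

/-- The coefficient of `t^n` (zero for `n > k`). -/
def coeff [AddCommGroup P] (n : ℕ) (x : TruncatedSeries k P) : P :=
  if h : n < k + 1 then x ⟨n, h⟩ else 0

/-- The inclusion of `P` as the constant series. -/
def const [AddCommGroup P] (k : ℕ) (x : P) : TruncatedSeries k P :=
  mk k (fun n => if n = 0 then x else 0)

section AddCommGroup

variable [AddCommGroup P]

theorem coeff_mk (a : ℕ → P) {n : ℕ} (h : n ≤ k) : coeff n (mk k a) = a n := by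
  simp [coeff, mk, Nat.lt_succ_of_le h]

theorem ext_coeff {x y : TruncatedSeries k P} (h : ∀ n ≤ k, coeff n x = coeff n y) : x = y := by
  funext i
  have hi := i.2
  have := h i (by omega)
  simpa [coeff, hi] using this

theorem coeff_add (n : ℕ) (x y : TruncatedSeries k P) :
    coeff n (x + y) = coeff n x + coeff n y := by
  unfold coeff
  split_ifs with h
  · rfl
  · simp

theorem coeff_zero (n : ℕ) : coeff n (0 : TruncatedSeries k P) = 0 := by
  unfold coeff
  split_ifs with h
  · rfl
  · rfl

theorem sum_assoc (F : ℕ → ℕ → ℕ → P) (n : ℕ) :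
    ∑ p ∈ Finset.HasAntidiagonal.antidiagonal n, ∑ q ∈ Finset.HasAntidiagonal.antidiagonal p.1, F q.1 q.2 p.2 =
      ∑ p ∈ Finset.HasAntidiagonal.antidiagonal n, ∑ q ∈ Finset.HasAntidiagonal.antidiagonal p.2, F p.1 q.1 q.2 := by
  simp only [Finset.sum_sigma']
  refine Finset.sum_nbij' (fun a => ⟨(a.2.1, a.2.2 + a.1.2), (a.2.2, a.1.2)⟩)
    (fun a => ⟨(a.1.1 + a.2.1, a.2.2), (a.1.1, a.2.1)⟩) ?_ ?_ ?_ ?_ ?_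
  all_goals
    rintro ⟨⟨a, b⟩, ⟨c, d⟩⟩ h
    simp only [Finset.mem_sigma, Finset.HasAntidiagonal.mem_antidiagonal] at h ⊢
    try grind

end AddCommGroup

/-- The action of `∑ t^i c_i` in `K[[t]]` by the Cauchy product. -/
noncomputable instance instSMul {K : Type*} [Semiring K] [AddCommGroup P] [Module K P] :
    SMul K⟦X⟧ (TruncatedSeries k P) where
  smul c x := mk k fun n =>
    ∑ p ∈ Finset.HasAntidiagonal.antidiagonal n, PowerSeries.coeff p.1 c • coeff p.2 x

/-- The Cauchy product, modulo `t^{k+1}`. -/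
instance instMul [NonUnitalCommRing P] : Mul (TruncatedSeries k P) where
  mul x y := mk k fun n => ∑ p ∈ Finset.HasAntidiagonal.antidiagonal n, coeff p.1 x * coeff p.2 y

theorem coeff_smul {K : Type*} [Semiring K] [AddCommGroup P] [Module K P] {n : ℕ} (h : n ≤ k)
    (c : K⟦X⟧) (x : TruncatedSeries k P) :
    coeff n (c • x) = ∑ p ∈ Finset.HasAntidiagonal.antidiagonal n, PowerSeries.coeff p.1 c • coeff p.2 x :=
  coeff_mk _ h

theorem coeff_mul [NonUnitalCommRing P] {n : ℕ} (h : n ≤ k) (x y : TruncatedSeries k P) :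
    coeff n (x * y) = ∑ p ∈ Finset.HasAntidiagonal.antidiagonal n, coeff p.1 x * coeff p.2 y :=
  coeff_mk _ h

noncomputable instance instModule {K : Type*} [CommRing K] [AddCommGroup P] [Module K P] :
    Module K⟦X⟧ (TruncatedSeries k P) where
  one_smul x := ext_coeff fun n hn => by
    rw [coeff_smul hn, Finset.sum_eq_single (0, n)]
    · simp
    · rintro ⟨a, b⟩ h hne
      have : a ≠ 0 := by
        rintro rfl
        simp at h
        simp [h] at hne
      simp [PowerSeries.coeff_one, this]
    · simp
  mul_smul c d x := ext_coeff fun n hn => by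
    rw [coeff_smul hn, coeff_smul hn]
    have h₁ : ∀ p ∈ Finset.HasAntidiagonal.antidiagonal n, PowerSeries.coeff p.1 (c * d) • coeff p.2 x =
        ∑ q ∈ Finset.HasAntidiagonal.antidiagonal p.1,
          PowerSeries.coeff q.1 c • PowerSeries.coeff q.2 d • coeff p.2 x := by
      intro p _
      simp only [PowerSeries.coeff_mul, Finset.sum_smul, mul_smul]
    have h₂ : ∀ p ∈ Finset.HasAntidiagonal.antidiagonal n, PowerSeries.coeff p.1 c • coeff p.2 (d • x) =
        ∑ q ∈ Finset.HasAntidiagonal.antidiagonal p.2,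
          PowerSeries.coeff p.1 c • PowerSeries.coeff q.1 d • coeff q.2 x := by
      intro p hp
      have := Finset.HasAntidiagonal.antidiagonal.snd_le hp
      rw [coeff_smul (this.trans hn), Finset.smul_sum]
    rw [Finset.sum_congr rfl h₁, Finset.sum_congr rfl h₂]
    exact sum_assoc (fun i j l => PowerSeries.coeff i c • PowerSeries.coeff j d • coeff l x) n
  smul_zero c := ext_coeff fun n hn => by simp [coeff_smul hn, coeff_zero]
  smul_add c x y := ext_coeff fun n hn => by
    simp [coeff_smul hn, coeff_add, Finset.sum_add_distrib]
  add_smul c d x := ext_coeff fun n hn => by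
    simp [coeff_smul hn, coeff_add, add_smul, Finset.sum_add_distrib]
  zero_smul x := ext_coeff fun n hn => by simp [coeff_smul hn, coeff_zero]

instance instNonUnitalCommRing [NonUnitalCommRing P] : NonUnitalCommRing (TruncatedSeries k P) :=
  { instAddCommGroup, instMul with
    left_distrib := fun x y z => ext_coeff fun n hn => by
      simp [coeff_mul hn, coeff_add, mul_add, Finset.sum_add_distrib]
    right_distrib := fun x y z => ext_coeff fun n hn => by
      simp [coeff_mul hn, coeff_add, add_mul, Finset.sum_add_distrib]
    zero_mul := fun x => ext_coeff fun n hn => by simp [coeff_mul hn, coeff_zero]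
    mul_zero := fun x => ext_coeff fun n hn => by simp [coeff_mul hn, coeff_zero]
    mul_assoc := fun x y z => ext_coeff fun n hn => by
      rw [coeff_mul hn, coeff_mul hn]
      have h₁ : ∀ p ∈ Finset.HasAntidiagonal.antidiagonal n, coeff p.1 (x * y) * coeff p.2 z =
          ∑ q ∈ Finset.HasAntidiagonal.antidiagonal p.1, coeff q.1 x * (coeff q.2 y * coeff p.2 z) := by
        intro p hp
        have := Finset.HasAntidiagonal.antidiagonal.fst_le hp
        simp only [coeff_mul (this.trans hn), Finset.sum_mul, mul_assoc]
      have h₂ : ∀ p ∈ Finset.HasAntidiagonal.antidiagonal n, coeff p.1 x * coeff p.2 (y * z) =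
          ∑ q ∈ Finset.HasAntidiagonal.antidiagonal p.2, coeff p.1 x * (coeff q.1 y * coeff q.2 z) := by
        intro p hp
        have := Finset.HasAntidiagonal.antidiagonal.snd_le hp
        simp only [coeff_mul (this.trans hn), Finset.mul_sum]
      rw [Finset.sum_congr rfl h₁, Finset.sum_congr rfl h₂]
      exact sum_assoc (fun i j l => coeff i x * (coeff j y * coeff l z)) n
    mul_comm := fun x y => ext_coeff fun n hn => by
      rw [coeff_mul hn, coeff_mul hn, ← Finset.Nat.sum_antidiagonal_swap]
      exact Finset.sum_congr rfl fun p _ => mul_comm _ _ }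

instance {K : Type*} [CommRing K] [NonUnitalCommRing P] [Module K P] [IsScalarTower K P P] :
    IsScalarTower K⟦X⟧ (TruncatedSeries k P) (TruncatedSeries k P) where
  smul_assoc c x y := ext_coeff fun n hn => by
    simp only [smul_eq_mul]
    rw [coeff_mul hn, coeff_smul hn]
    have h₁ : ∀ p ∈ Finset.HasAntidiagonal.antidiagonal n, coeff p.1 (c • x) * coeff p.2 y =
        ∑ q ∈ Finset.HasAntidiagonal.antidiagonal p.1, PowerSeries.coeff q.1 c • (coeff q.2 x * coeff p.2 y) := by
      intro p hp
      have := Finset.HasAntidiagonal.antidiagonal.fst_le hp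
      simp only [coeff_smul (this.trans hn), Finset.sum_mul, smul_mul_assoc]
    have h₂ : ∀ p ∈ Finset.HasAntidiagonal.antidiagonal n, PowerSeries.coeff p.1 c • coeff p.2 (x * y) =
        ∑ q ∈ Finset.HasAntidiagonal.antidiagonal p.2, PowerSeries.coeff p.1 c • (coeff q.1 x * coeff q.2 y) := by
      intro p hp
      have := Finset.HasAntidiagonal.antidiagonal.snd_le hp
      simp only [coeff_mul (this.trans hn), Finset.smul_sum]
    rw [Finset.sum_congr rfl h₁, Finset.sum_congr rfl h₂]
    exact sum_assoc (fun i j l => PowerSeries.coeff i c • (coeff j x * coeff l y)) n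

instance {K : Type*} [CommRing K] [NonUnitalCommRing P] [Module K P] [IsScalarTower K P P] :
    SMulCommClass K⟦X⟧ (TruncatedSeries k P) (TruncatedSeries k P) where
  smul_comm c x y := by
    simp only [smul_eq_mul]
    rw [mul_comm x (c • y), mul_comm x y]
    exact (smul_mul_assoc c y x).symm

/-- The grading of `P_k[[t]]` induced by a grading of `P` (the variable `t` is even). -/
def grading {K : Type*} [CommRing K] [AddCommGroup P] [Module K P] (k : ℕ)
    (𝒜 : ZMod 2 → Submodule K P) (i : ZMod 2) : Submodule K⟦X⟧ (TruncatedSeries k P) where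
  carrier := {x | ∀ n, coeff n x ∈ 𝒜 i}
  add_mem' := fun hx hy n => by
    rw [coeff_add]
    exact add_mem (hx n) (hy n)
  zero_mem' := fun n => by
    rw [coeff_zero]
    exact zero_mem _
  smul_mem' := fun c x hx n => by
    by_cases hn : n ≤ k
    · rw [coeff_smul hn]
      exact sum_mem fun p _ => Submodule.smul_mem _ _ (hx _)
    · have : ¬ n < k + 1 := by omega
      simp [coeff, this]

theorem const_mem_grading {K : Type*} [CommRing K] [AddCommGroup P] [Module K P] (k : ℕ)
    (𝒜 : ZMod 2 → Submodule K P) {i : ZMod 2} {x : P} (hx : x ∈ 𝒜 i) :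
    const k x ∈ grading k 𝒜 i := by
  intro n
  by_cases hn : n ≤ k
  · rw [const, coeff_mk _ hn]
    split_ifs
    · exact hx
    · exact zero_mem _
  · have : ¬ n < k + 1 := by omega
    simp [coeff, this]

/-- An odd element of `P` as an odd constant series. -/
def constOdd {K : Type*} [CommRing K] [AddCommGroup P] [Module K P] (k : ℕ)
    {𝒜 : ZMod 2 → Submodule K P} (x : 𝒜 1) : grading k 𝒜 1 :=
  ⟨const k (x : P), const_mem_grading k 𝒜 x.2⟩

end TruncatedSeries

open TruncatedSeries in
/-- The maps `μ_0, …, μ_k` and `ω_0, …, ω_k`, where `(μ_0, ω_0) = ({-,-}, s)`, define a formal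
deformation of order `k` of `(P, {-,-}, s)`: there is a structure of Poisson superalgebra over
`K[[t]]` on `P_k[[t]]`, with its given product and grading, such that
`μ_(k)(x, y) = ∑_{i ≤ k} t^i μ_i(x, y)` and `ω_(k)(z) = ∑_{i ≤ k} t^i ω_i(z)` for `x, y ∈ P` and
`z ∈ P` odd.  Since `P` generates `P_k[[t]]` over `K[[t]]`, a bilinear bracket and a quadratic
squaring are determined by these values. -/
def IsDeformationOfOrder {K P : Type*} [Field K] [NonUnitalCommRing P] [Module K P]
    [IsScalarTower K P P] [SMulCommClass K P P] (𝒜 : ZMod 2 → Submodule K P)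
    (br : P → P → P) (s : 𝒜 1 → P) (k : ℕ) (μ : ℕ → P → P → P) (ω : ℕ → 𝒜 1 → P) : Prop :=
  μ 0 = br ∧ ω 0 = s ∧
    ∃ (brₖ : TruncatedSeries k P → TruncatedSeries k P → TruncatedSeries k P)
      (sₖ : grading k 𝒜 1 → TruncatedSeries k P),
      IsPoissonSuperalgebra K⟦X⟧ (grading k 𝒜) brₖ sₖ ∧
      (∀ x y, brₖ (const k x) (const k y) = mk k fun i => μ i x y) ∧
      (∀ z : 𝒜 1, sₖ (constOdd k z) = mk k fun i => ω i z)

/-!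
A deformation of order `m` is determined by its coefficients `μ_0, …, μ_m` and `ω_0, …, ω_m`, and
the axioms of a Poisson superalgebra on `P_m[[t]]` are equivalent to conditions on these
coefficients (`IsTruncatedPoisson`): every `(μ_n, ω_n)` is an even Poisson 2-cochain, and for all
`n ≤ m`
`∑_{i+j=n} (μ_i(x, μ_j(y, z)) + μ_i(y, μ_j(z, x)) + μ_i(z, μ_j(x, y))) = 0` and
`∑_{i+j=n} (μ_i(y, ω_j(x)) + μ_i(x, μ_j(x, y))) = 0`.
In degree `k + 1`, the terms with `i` and `j` nonzero are the obstruction, and the terms with `i` or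
`j` zero are the coboundary of `(μ_{k+1}, ω_{k+1})`; in characteristic 2 their sum vanishes exactly
when they are equal (`isTruncatedPoisson_succ_iff`).

The equivalence is `isDeformationOfOrder_iff`.  One direction reads off the coefficients, using that
in characteristic 2 the bracket is alternating and satisfies the Jacobi identity on all of `P`
(`IsLieSuperalgebra.jacobi`).  For the other, the `μ_n` are extended to a `K[[t]]`-bilinear bracket
on `P_m[[t]]`.  The odd part is a free module over the field `K`, so the quadratic map `ω_n` is the
diagonal of a bilinear map `γ_n`, and the squaring on `P_m[[t]]` is the diagonal of the bilinear
extension of the `γ_n`.  It is then enough to check the axioms on constants, which generate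
`P_m[[t]]` over `K[[t]]` (`grading_induction`): the failure of a multilinear axiom is additive in
each argument, and so is that of a quadratic one once its polarization is known to hold.

The obstruction is a cochain (`isEvenPoissonCochain₃_obs`) because a composition of two
biderivations fails to be a derivation by a term symmetric in the two; the sum over `i + j = k + 1`
contains each such term twice.
-/

/-! ### Truncated power series -/

namespace TruncatedSeries

section Module

variable {K P : Type*} [CommRing K] [AddCommGroup P] [Module K P] {k : ℕ}

theorem sum_antidiagonal_eq_of_left_ne_zero {n : ℕ} {f : ℕ × ℕ → P}
    (h : ∀ i j, i ≠ 0 → i ≤ n → f (i, j) = 0) :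
    ∑ p ∈ Finset.HasAntidiagonal.antidiagonal n, f p = f (0, n) := by
  refine Finset.sum_eq_single (0, n) ?_ (by simp)
  rintro ⟨i, j⟩ hp hne
  rw [Finset.HasAntidiagonal.mem_antidiagonal] at hp
  exact h i j (by grind) (by grind)

theorem sum_antidiagonal_eq_of_right_ne_zero {n : ℕ} {f : ℕ × ℕ → P}
    (h : ∀ i j, j ≠ 0 → j ≤ n → f (i, j) = 0) :
    ∑ p ∈ Finset.HasAntidiagonal.antidiagonal n, f p = f (n, 0) := by
  rw [← Finset.Nat.sum_antidiagonal_swap]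
  exact sum_antidiagonal_eq_of_left_ne_zero fun i j => h j i

theorem coeff_const (x : P) {n : ℕ} (h : n ≤ k) :
    coeff n (const k x) = if n = 0 then x else 0 :=
  coeff_mk _ h

theorem coeff_eq_zero (x : TruncatedSeries k P) {n : ℕ} (h : k < n) : coeff n x = 0 := by
  have : ¬ n < k + 1 := by omega
  simp [coeff, this]

theorem mk_add_mk (a b : ℕ → P) :
    mk k a + mk k b = mk k fun n => a n + b n := rfl

theorem mk_eq_mk_iff {a b : ℕ → P} :
    mk k a = mk k b ↔ ∀ n ≤ k, a n = b n :=
  ⟨fun h n hn => by rw [← coeff_mk a hn, h, coeff_mk b hn],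
    fun h => ext_coeff fun n hn => by rw [coeff_mk a hn, coeff_mk b hn, h n hn]⟩

theorem mk_mem_grading {𝒜 : ZMod 2 → Submodule K P} {i : ZMod 2} {a : ℕ → P} :
    mk k a ∈ grading k 𝒜 i ↔ ∀ n ≤ k, a n ∈ 𝒜 i := by
  refine ⟨fun h n hn => by simpa [coeff_mk a hn] using h n, fun h n => ?_⟩
  by_cases hn : n ≤ k
  · rw [coeff_mk a hn]
    exact h n hn
  · rw [coeff_eq_zero _ (not_le.1 hn)]
    exact zero_mem _

theorem const_add (x y : P) : const k (x + y) = const k x + const k y :=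
  ext_coeff fun n hn => by
    rw [coeff_add, coeff_const _ hn, coeff_const _ hn, coeff_const _ hn]
    split_ifs <;> simp

theorem C_smul_mk (c : K) (a : ℕ → P) :
    PowerSeries.C c • mk k a = mk k fun n => c • a n :=
  ext_coeff fun n hn => by
    rw [coeff_smul hn, coeff_mk _ hn, sum_antidiagonal_eq_of_left_ne_zero]
    · simp [coeff_mk _ hn]
    · intro i j hi _
      simp [PowerSeries.coeff_C, hi]

theorem const_smul (c : K) (x : P) : const k (c • x) = PowerSeries.C c • const k x := by
  rw [const, const, C_smul_mk]
  congr 1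
  ext n
  split_ifs <;> simp

theorem coeff_sum {ι : Type*} (t : Finset ι) (f : ι → TruncatedSeries k P) (n : ℕ) :
    coeff n (∑ i ∈ t, f i) = ∑ i ∈ t, coeff n (f i) := by
  classical
  induction t using Finset.induction_on with
  | empty => simp [coeff_zero]
  | insert i t hi ih => rw [Finset.sum_insert hi, Finset.sum_insert hi, coeff_add, ih]

theorem eq_sum_X_pow_smul_const (x : TruncatedSeries k P) :
    x = ∑ n ∈ Finset.range (k + 1), (PowerSeries.X ^ n : K⟦X⟧) • const k (coeff n x) := by
  refine ext_coeff fun i hi => ?_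
  rw [coeff_sum]
  have key : ∀ n ∈ Finset.range (k + 1),
      coeff i ((PowerSeries.X ^ n : K⟦X⟧) • const k (coeff n x)) =
        if n = i then coeff n x else 0 := by
    intro n _
    rw [coeff_smul hi, sum_antidiagonal_eq_of_right_ne_zero]
    · simp [coeff_const, PowerSeries.coeff_X_pow, eq_comm]
    · intro a b hb hbi
      simp [coeff_const _ (hbi.trans hi), hb]
  rw [Finset.sum_congr rfl key, Finset.sum_ite_eq', if_pos (Finset.mem_range.2 (by omega))]

/-- The homogeneous component `P_k[[t]]_i` is generated over `K[[t]]` by the constants in `P_i`. -/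
theorem grading_le_span (𝒜 : ZMod 2 → Submodule K P) (i : ZMod 2) :
    grading k 𝒜 i ≤ Submodule.span K⟦X⟧ (const k '' (𝒜 i : Set P)) := by
  intro x hx
  rw [eq_sum_X_pow_smul_const (K := K) x]
  exact sum_mem fun n _ => Submodule.smul_mem _ _ (Submodule.subset_span ⟨_, hx n, rfl⟩)

/-- To prove a property of the homogeneous elements of degree `i`, it suffices to prove it for
constants and to show that it is stable under addition and under the action of `K[[t]]`. -/
theorem grading_induction {𝒜 : ZMod 2 → Submodule K P} {i : ZMod 2}
    {p : TruncatedSeries k P → Prop} (const : ∀ x ∈ 𝒜 i, p (const k x))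
    (add : ∀ x ∈ grading k 𝒜 i, ∀ y ∈ grading k 𝒜 i, p x → p y → p (x + y))
    (smul : ∀ (c : K⟦X⟧), ∀ x ∈ grading k 𝒜 i, p x → p (c • x))
    {x : TruncatedSeries k P} (hx : x ∈ grading k 𝒜 i) : p x := by
  have hle : Submodule.span K⟦X⟧ (TruncatedSeries.const k '' (𝒜 i : Set P)) ≤ grading k 𝒜 i := by
    rw [Submodule.span_le]
    rintro _ ⟨y, hy, rfl⟩
    exact const_mem_grading k 𝒜 hy
  refine Submodule.span_induction (p := fun x _ => p x) ?_ ?_ ?_ ?_ (grading_le_span 𝒜 i hx)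
  · rintro _ ⟨y, hy, rfl⟩
    exact const y hy
  · have := smul 0 _ (const_mem_grading k 𝒜 (zero_mem _)) (const 0 (zero_mem _))
    rwa [zero_smul] at this
  · exact fun x y hx hy => add x (hle hx) y (hle hy)
  · exact fun c x hx => smul c x (hle hx)

variable (K) in
@[elab_as_elim]
theorem induction_const {p : TruncatedSeries k P → Prop} (const : ∀ x, p (const k x))
    (add : ∀ x y, p x → p y → p (x + y)) (smul : ∀ (c : K⟦X⟧) (x), p x → p (c • x))
    (x : TruncatedSeries k P) : p x :=
  grading_induction (K := K) (𝒜 := fun _ => ⊤) (i := 0) (fun x _ => const x)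
    (fun x _ y _ => add x y) (fun c x _ => smul c x) (fun _ => Submodule.mem_top)

theorem sum_antidiagonal_left_comm (F : ℕ → ℕ → ℕ → P) (n : ℕ) :
    ∑ p ∈ Finset.HasAntidiagonal.antidiagonal n,
        ∑ q ∈ Finset.HasAntidiagonal.antidiagonal p.2, F p.1 q.1 q.2 =
      ∑ p ∈ Finset.HasAntidiagonal.antidiagonal n,
        ∑ q ∈ Finset.HasAntidiagonal.antidiagonal p.2, F q.1 p.1 q.2 := by
  rw [← sum_assoc F, ← sum_assoc fun a b c => F b a c]
  exact Finset.sum_congr rfl fun p _ => (Finset.Nat.sum_antidiagonal_swap (n := p.1)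
    (f := fun q => F q.1 q.2 p.2)).symm

/-- The function underlying `extendBilin`. -/
def extendBilinFun (k : ℕ) (β : ℕ → P →ₗ[K] P →ₗ[K] P) (x y : TruncatedSeries k P) :
    TruncatedSeries k P :=
  mk k fun n => ∑ p ∈ Finset.HasAntidiagonal.antidiagonal n,
    ∑ q ∈ Finset.HasAntidiagonal.antidiagonal p.2, β p.1 (coeff q.1 x) (coeff q.2 y)

theorem extendBilinFun_smul_left (β : ℕ → P →ₗ[K] P →ₗ[K] P) (c : K⟦X⟧)
    (x y : TruncatedSeries k P) :
    extendBilinFun k β (c • x) y = c • extendBilinFun k β x y := by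
  refine ext_coeff fun n hn => ?_
  rw [extendBilinFun, coeff_mk _ hn, coeff_smul hn]
  have h₁ : ∀ p ∈ Finset.HasAntidiagonal.antidiagonal n,
      ∑ q ∈ Finset.HasAntidiagonal.antidiagonal p.2, β p.1 (coeff q.1 (c • x)) (coeff q.2 y) =
      ∑ q ∈ Finset.HasAntidiagonal.antidiagonal p.2,
        ∑ r ∈ Finset.HasAntidiagonal.antidiagonal q.2,
          PowerSeries.coeff q.1 c • β p.1 (coeff r.1 x) (coeff r.2 y) := by
    intro p hp
    rw [← sum_assoc (fun i j l => PowerSeries.coeff i c • β p.1 (coeff j x) (coeff l y))]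
    refine Finset.sum_congr rfl fun q hq => ?_
    have h₃ := Finset.HasAntidiagonal.antidiagonal.fst_le hq
    have h₄ := Finset.HasAntidiagonal.antidiagonal.snd_le hp
    rw [coeff_smul ((h₃.trans h₄).trans hn)]
    simp only [map_sum, map_smul, LinearMap.sum_apply, LinearMap.smul_apply]
  have h₂ : ∀ p ∈ Finset.HasAntidiagonal.antidiagonal n,
      PowerSeries.coeff p.1 c • coeff p.2 (extendBilinFun k β x y) =
      ∑ q ∈ Finset.HasAntidiagonal.antidiagonal p.2,
        ∑ r ∈ Finset.HasAntidiagonal.antidiagonal q.2,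
          PowerSeries.coeff p.1 c • β q.1 (coeff r.1 x) (coeff r.2 y) := by
    intro p hp
    have := Finset.HasAntidiagonal.antidiagonal.snd_le hp
    rw [extendBilinFun, coeff_mk _ (this.trans hn)]
    simp only [Finset.smul_sum]
  rw [Finset.sum_congr rfl h₁, Finset.sum_congr rfl h₂]
  exact sum_antidiagonal_left_comm (fun a i d => ∑ r ∈ Finset.HasAntidiagonal.antidiagonal d,
    PowerSeries.coeff i c • β a (coeff r.1 x) (coeff r.2 y)) n

theorem extendBilinFun_flip (β : ℕ → P →ₗ[K] P →ₗ[K] P) (x y : TruncatedSeries k P) :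
    extendBilinFun k (fun n => (β n).flip) x y = extendBilinFun k β y x :=
  congrArg (mk k) <| funext fun _ => Finset.sum_congr rfl fun p _ =>
    Finset.Nat.sum_antidiagonal_swap (n := p.2)
      (f := fun q => β p.1 (coeff q.1 y) (coeff q.2 x))

/-- The extension of a family `β_0, β_1, …` of bilinear maps on `P` to a `K[[t]]`-bilinear map on
`P_k[[t]]`: the one that takes constants `x`, `y` to `∑ t^n β_n(x, y)`. -/
noncomputable def extendBilin (k : ℕ) (β : ℕ → P →ₗ[K] P →ₗ[K] P) :
    TruncatedSeries k P →ₗ[K⟦X⟧] TruncatedSeries k P →ₗ[K⟦X⟧] TruncatedSeries k P :=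
  LinearMap.mk₂ K⟦X⟧ (extendBilinFun k β)
    (fun x x' y => ext_coeff fun n hn => by
      simp only [extendBilinFun, coeff_mk _ hn, coeff_add, map_add, LinearMap.add_apply,
        Finset.sum_add_distrib])
    (extendBilinFun_smul_left β)
    (fun x y y' => ext_coeff fun n hn => by
      simp only [extendBilinFun, coeff_mk _ hn, coeff_add, map_add, Finset.sum_add_distrib])
    (fun c x y => by
      rw [← extendBilinFun_flip, ← extendBilinFun_flip β y, extendBilinFun_smul_left])

theorem coeff_extendBilin (β : ℕ → P →ₗ[K] P →ₗ[K] P) (x y : TruncatedSeries k P) {n : ℕ}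
    (hn : n ≤ k) : coeff n (extendBilin k β x y) =
      ∑ p ∈ Finset.HasAntidiagonal.antidiagonal n,
        ∑ q ∈ Finset.HasAntidiagonal.antidiagonal p.2, β p.1 (coeff q.1 x) (coeff q.2 y) :=
  coeff_mk (fun n => ∑ p ∈ Finset.HasAntidiagonal.antidiagonal n,
    ∑ q ∈ Finset.HasAntidiagonal.antidiagonal p.2, β p.1 (coeff q.1 x) (coeff q.2 y)) hn

theorem extendBilin_const_left (β : ℕ → P →ₗ[K] P →ₗ[K] P) (x : P) (a : ℕ → P) :
    extendBilin k β (const k x) (mk k a) = mk k fun n =>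
      ∑ p ∈ Finset.HasAntidiagonal.antidiagonal n, β p.1 x (a p.2) := by
  refine ext_coeff fun n hn => ?_
  rw [coeff_extendBilin _ _ _ hn, coeff_mk _ hn]
  refine Finset.sum_congr rfl fun p hp => ?_
  have hp := (Finset.HasAntidiagonal.antidiagonal.snd_le hp).trans hn
  rw [sum_antidiagonal_eq_of_left_ne_zero]
  · simp [coeff_const, coeff_mk _ hp]
  · intro i j hi hip
    simp [coeff_const _ (hip.trans hp), hi]

theorem extendBilin_const (β : ℕ → P →ₗ[K] P →ₗ[K] P) (x y : P) :
    extendBilin k β (const k x) (const k y) = mk k fun n => β n x y := by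
  rw [const.eq_def k y, extendBilin_const_left]
  refine congrArg (mk k) (funext fun n => ?_)
  rw [sum_antidiagonal_eq_of_right_ne_zero]
  · simp
  · intro i j hj _
    simp [hj]

end Module

section Ring

variable {P : Type*} [NonUnitalCommRing P] {k : ℕ}

theorem const_mul_mk (x : P) (a : ℕ → P) : const k x * mk k a = mk k fun n => x * a n := by
  refine ext_coeff fun n hn => ?_
  rw [coeff_mul hn, coeff_mk _ hn, sum_antidiagonal_eq_of_left_ne_zero]
  · simp [coeff_const, coeff_mk _ hn]
  · intro i j hi hin
    simp [coeff_const _ (hin.trans hn), hi]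

theorem const_mul (x y : P) : const k (x * y) = const k x * const k y := by
  rw [const.eq_def k y, const_mul_mk, const]
  congr 1
  ext n
  split_ifs <;> simp

end Ring

end TruncatedSeries

/-! ### Lie superalgebras in characteristic 2 -/

theorem add_self_eq_zero_of_charP_two (K : Type*) {P : Type*} [Field K] [CharP K 2]
    [AddCommGroup P] [Module K P] (x : P) : x + x = 0 := by
  rw [← two_smul K x, CharTwo.two_eq_zero, zero_smul]

theorem add_eq_zero_iff_eq_of_add_self {P : Type*} [AddCommGroup P] (h2 : ∀ x : P, x + x = 0)
    {x y : P} : x + y = 0 ↔ x = y := by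
  rw [add_eq_zero_iff_eq_neg, neg_eq_of_add_eq_zero_left (h2 y)]

namespace TruncatedSeries

theorem add_self {P : Type*} [AddCommGroup P] (h2 : ∀ x : P, x + x = 0) {k : ℕ}
    (x : TruncatedSeries k P) : x + x = 0 :=
  ext_coeff fun n _ => by rw [coeff_add, h2, coeff_zero]

end TruncatedSeries

theorem IsCompl.exists_add_eq {R L : Type*} [CommRing R] [AddCommGroup L] [Module R L]
    {U V : Submodule R L} (h : IsCompl U V) (x : L) : ∃ u ∈ U, ∃ v ∈ V, u + v = x :=
  Submodule.mem_sup.1 (h.sup_eq_top ▸ Submodule.mem_top)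

/-- In characteristic 2 the bracket of a Lie superalgebra is alternating on the whole space:
on odd elements `[x, x] = s (2 x) - 2 s x`. -/
theorem IsLieSuperalgebra.bracket_self {R L : Type*} [CommRing R] [AddCommGroup L] [Module R L]
    {𝒜 : ZMod 2 → Submodule R L} {br : L → L → L} {s : 𝒜 1 → L}
    (h : IsLieSuperalgebra R 𝒜 br s) (h2 : ∀ x : L, x + x = 0) (x : L) : br x x = 0 := by
  obtain ⟨a, ha, b, hb, rfl⟩ := h.isCompl.exists_add_eq x
  rw [(h.linear_left _).map_add, (h.linear_right _).map_add, (h.linear_right _).map_add,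
    h.even_self a ha, h.odd_symm a ha b hb]
  have hs : s 0 = 0 := by simpa using h.sq_smul 0 0
  have hbb := h.sq_polar ⟨b, hb⟩ ⟨b, hb⟩
  rw [show (⟨b, hb⟩ + ⟨b, hb⟩ : 𝒜 1) = 0 from Subtype.ext (h2 b), hs] at hbb
  simp only at hbb
  rw [hbb, zero_sub, ← neg_add', h2, neg_zero, zero_add, add_zero, h2]

theorem IsLieSuperalgebra.bracket_symm {R L : Type*} [CommRing R] [AddCommGroup L] [Module R L]
    {𝒜 : ZMod 2 → Submodule R L} {br : L → L → L} {s : 𝒜 1 → L}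
    (h : IsLieSuperalgebra R 𝒜 br s) (h2 : ∀ x : L, x + x = 0) (x y : L) : br x y = br y x := by
  have hxy := h.bracket_self h2 (x + y)
  rw [(h.linear_left _).map_add, (h.linear_right _).map_add, (h.linear_right _).map_add,
    h.bracket_self h2, h.bracket_self h2] at hxy
  have := h2 (br x y)
  grind

/-- The Jacobi identity holds on the whole space: with two odd arguments it is the polarization of
`[s x, z] = [x, [x, z]]`. -/
theorem IsLieSuperalgebra.jacobi {R L : Type*} [CommRing R] [AddCommGroup L] [Module R L]
    {𝒜 : ZMod 2 → Submodule R L} {br : L → L → L} {s : 𝒜 1 → L}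
    (h : IsLieSuperalgebra R 𝒜 br s) (h2 : ∀ x : L, x + x = 0) (x y z : L) :
    br x (br y z) + br y (br z x) + br z (br x y) = 0 := by
  have add_left : ∀ x y z, br (x + y) z = br x z + br y z := fun x y z =>
    (h.linear_left z).map_add x y
  have add_right : ∀ x y z, br x (y + z) = br x y + br x z := fun x y z =>
    (h.linear_right x).map_add y z
  have sub_left : ∀ x y z, br (x - y) z = br x z - br y z := fun x y z =>
    (h.linear_left z).map_sub x y
  have symm := h.bracket_symm h2
  have odd_odd : ∀ x ∈ 𝒜 1, ∀ y ∈ 𝒜 1, ∀ z,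
      br x (br y z) + br y (br z x) + br z (br x y) = 0 := by
    intro x hx y hy z
    have e := h.sq_polar ⟨x, hx⟩ ⟨y, hy⟩
    have e₁ := h.sq_jacobi (⟨x, hx⟩ + ⟨y, hy⟩) z
    have e₂ := h.sq_jacobi ⟨x, hx⟩ z
    have e₃ := h.sq_jacobi ⟨y, hy⟩ z
    simp only [Submodule.coe_add] at e e₁ e₂ e₃
    rw [symm z (br x y), e, sub_left, sub_left, e₁, e₂, e₃, symm z x, add_left, add_left, add_right,
      add_right]
    have := h2 (br x (br y z))
    have := h2 (br y (br x z))
    grind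
  have even_even : ∀ x ∈ 𝒜 0, ∀ y ∈ 𝒜 0, ∀ z,
      br x (br y z) + br y (br z x) + br z (br x y) = 0 := by
    intro x hx y hy z
    obtain ⟨a, ha, b, hb, rfl⟩ := h.isCompl.exists_add_eq z
    have e₁ := h.even_jacobi x hx y hy a ha
    have e₂ := h.odd_module x hx y hy b hb
    have := h2 (br x (br y b))
    simp only [add_left, add_right]
    rw [symm b x, symm b, e₂]
    grind
  obtain ⟨x₀, hx₀, x₁, hx₁, rfl⟩ := h.isCompl.exists_add_eq x
  obtain ⟨y₀, hy₀, y₁, hy₁, rfl⟩ := h.isCompl.exists_add_eq y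
  obtain ⟨z₀, hz₀, z₁, hz₁, rfl⟩ := h.isCompl.exists_add_eq z
  -- Among three homogeneous arguments, two have the same parity.
  have e₁ := even_even x₀ hx₀ y₀ hy₀ (z₀ + z₁)
  have e₂ := odd_odd x₁ hx₁ y₁ hy₁ (z₀ + z₁)
  have e₃ := even_even z₀ hz₀ x₀ hx₀ y₁
  have e₄ := odd_odd y₁ hy₁ z₁ hz₁ x₀
  have e₅ := even_even y₀ hy₀ z₀ hz₀ x₁
  have e₆ := odd_odd z₁ hz₁ x₁ hx₁ y₀
  simp only [add_left, add_right] at e₁ e₂ ⊢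
  grind

/-! ### Deformations in terms of their coefficients -/

section Cochain

variable {K P : Type*} [Field K] [NonUnitalCommRing P] [Module K P]
  {𝒜 : ZMod 2 → Submodule K P} {φ : P → P → P} {ω : 𝒜 1 → P}

theorem IsLieCochain₂.symm (h : IsLieCochain₂ 𝒜 φ ω) (h2 : ∀ x : P, x + x = 0) (x y : P) :
    φ x y = φ y x := by
  have hxy := h.alternating (x + y)
  rw [(h.linear₁ _).map_add, (h.linear₂ _).map_add, (h.linear₂ _).map_add,
    h.alternating, h.alternating] at hxy
  have := h2 (φ x y)
  grind

/-- The first component of a 2-cochain as a bilinear map. -/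
def IsLieCochain₂.toBilin (h : IsLieCochain₂ 𝒜 φ ω) : P →ₗ[K] P →ₗ[K] P :=
  LinearMap.mk₂ K φ
    (fun x y z => (h.linear₁ z).map_add x y) (fun c x y => (h.linear₁ y).map_smul c x)
    (fun x y z => (h.linear₂ x).map_add y z) (fun c x y => (h.linear₂ x).map_smul c y)

/-- The squaring part `ω` of a 2-cochain is the diagonal of a bilinear map: it is a quadratic map
with polar form `φ`, and a module over a field is free.  The bilinear map is extended from the odd
part to `P` by the projection along the even part. -/
theorem IsLieCochain₂.exists_bilin (h : IsLieCochain₂ 𝒜 φ ω) (hc : IsCompl (𝒜 0) (𝒜 1)) :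
    ∃ β : P →ₗ[K] P →ₗ[K] P, ∀ x : 𝒜 1, β x x = ω x := by
  let Q : QuadraticMap K (𝒜 1) P :=
    { toFun := ω
      toFun_smul := fun c x => by rw [h.smul, sq]
      exists_companion' := ⟨h.toBilin.compl₁₂ (𝒜 1).subtype (𝒜 1).subtype, h.add⟩ }
  obtain ⟨B, hB⟩ := LinearMap.BilinMap.toQuadraticMap_surjective (R := K) Q
  let pr := (𝒜 1).projectionOnto (𝒜 0) hc.symm
  refine ⟨B.compl₁₂ pr pr, fun x => ?_⟩
  rw [LinearMap.compl₁₂_apply, Submodule.projectionOnto_apply_left]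
  exact congrArg (fun q : QuadraticMap K (𝒜 1) P => q x) hB

end Cochain

/-- The conditions on the coefficients `μ_0, …, μ_m` and `ω_0, …, ω_m` under which
`(∑ t^n μ_n, ∑ t^n ω_n)` is a Poisson superalgebra structure on `P_m[[t]]`: each `(μ_n, ω_n)` is an
even Poisson 2-cochain, and the Jacobi identities for the bracket and for the squaring hold in each
degree `n ≤ m`. -/
structure IsTruncatedPoisson {K P : Type*} [Field K] [NonUnitalCommRing P] [Module K P]
    (𝒜 : ZMod 2 → Submodule K P) (m : ℕ) (μ : ℕ → P → P → P) (ω : ℕ → 𝒜 1 → P) : Prop where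
  cochain : ∀ n ≤ m, IsEvenPoissonCochain₂ 𝒜 (μ n) (ω n)
  jacobi : ∀ n ≤ m, ∀ x y z, ∑ p ∈ Finset.HasAntidiagonal.antidiagonal n,
    (μ p.1 x (μ p.2 y z) + μ p.1 y (μ p.2 z x) + μ p.1 z (μ p.2 x y)) = 0
  sq_jacobi : ∀ n ≤ m, ∀ (x : 𝒜 1) y, ∑ p ∈ Finset.HasAntidiagonal.antidiagonal n,
    (μ p.1 y (ω p.2 x) + μ p.1 x (μ p.2 x y)) = 0

section Deformation

open TruncatedSeries

variable {K P : Type*} [Field K] [NonUnitalCommRing P] [Module K P] [IsScalarTower K P P]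

/-- The coefficients of a Poisson superalgebra structure on `P_m[[t]]`. -/
theorem isTruncatedPoisson_of_isPoissonSuperalgebra (h2 : ∀ x : P, x + x = 0)
    {𝒜 : ZMod 2 → Submodule K P} {m : ℕ} {μ : ℕ → P → P → P} {ω : ℕ → 𝒜 1 → P}
    {b : TruncatedSeries m P → TruncatedSeries m P → TruncatedSeries m P}
    {q : grading m 𝒜 1 → TruncatedSeries m P} (h : IsPoissonSuperalgebra K⟦X⟧ (grading m 𝒜) b q)
    (hb : ∀ x y, b (const m x) (const m y) = mk m fun i => μ i x y)
    (hq : ∀ z : 𝒜 1, q (constOdd m z) = mk m fun i => ω i z) :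
    IsTruncatedPoisson 𝒜 m μ ω := by
  have h2' := add_self h2 (k := m)
  have symm := h.bracket_symm h2'
  have cochain : ∀ n ≤ m, IsEvenPoissonCochain₂ 𝒜 (μ n) (ω n) := by
    intro n hn
    have lin : ∀ y, IsLinearMap K fun x => μ n x y := fun y =>
      { map_add := fun x x' => by
          have := (h.linear_left (const m y)).map_add (const m x) (const m x')
          rw [← const_add, hb, hb, hb, mk_add_mk] at this
          exact mk_eq_mk_iff.1 this n hn
        map_smul := fun c x => by
          have := (h.linear_left (const m y)).map_smul (PowerSeries.C c) (const m x)
          rw [← const_smul, hb, hb, C_smul_mk] at this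
          exact mk_eq_mk_iff.1 this n hn }
    have symm' : ∀ x y, μ n x y = μ n y x := fun x y => by
      have := symm (const m x) (const m y)
      rw [hb, hb] at this
      exact mk_eq_mk_iff.1 this n hn
    exact
    { linear₁ := lin
      linear₂ := fun x => by
        have := lin x
        simpa only [symm' _ x] using this
      alternating := fun x => by
        have := h.bracket_self h2' (const m x)
        rw [hb] at this
        rw [← coeff_mk (fun i => μ i x x) hn, this, coeff_zero]
      smul := fun c x => by
        have := h.sq_smul (PowerSeries.C c) (constOdd m x)
        rw [show PowerSeries.C c • constOdd m x = constOdd m (c • x) from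
          Subtype.ext (const_smul c (x : P)).symm, hq, hq, ← map_pow, C_smul_mk] at this
        exact mk_eq_mk_iff.1 this n hn
      add := fun x y => by
        have := h.sq_polar (constOdd m x) (constOdd m y)
        rw [show constOdd m x + constOdd m y = constOdd m (x + y) from
          Subtype.ext (const_add (x : P) y).symm, hq, hq, hq, eq_sub_iff_add_eq,
          eq_sub_iff_add_eq] at this
        erw [hb] at this
        rw [mk_add_mk, mk_add_mk] at this
        rw [← mk_eq_mk_iff.1 this n hn]
        abel
      derivation := fun x y z => by
        have := h.leibniz (const m x) (const m y) (const m z)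
        rw [← const_mul, hb, hb, hb, mul_comm _ (const m y), const_mul_mk, const_mul_mk,
          mk_add_mk] at this
        exact mk_eq_mk_iff.1 this n hn
      mul := fun x y hy w hw => by
        have := h.sq_mul (const m y) (const_mem_grading m 𝒜 hy) (constOdd m x) (constOdd m w)
          (by
            change const m (w : P) = const m y * const m (x : P)
            rw [hw, ← const_mul, mul_comm])
        rw [hq, hq] at this
        change _ = _ + const m y * const m (x : P) * b (const m y) (const m (x : P)) at this
        rw [hb, ← const_mul, ← const_mul, const_mul_mk, const_mul_mk, mk_add_mk] at this
        rw [mk_eq_mk_iff.1 this n hn, mul_comm y x, symm' y x]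
      even_fst := fun i j x hx y hy => by
        have := h.bracket_mem i j _ (const_mem_grading m 𝒜 hx) _ (const_mem_grading m 𝒜 hy)
        rw [hb, mk_mem_grading] at this
        exact this n hn
      even_snd := fun x => by
        have := h.sq_mem (constOdd m x)
        rw [hq, mk_mem_grading] at this
        exact this n hn }
  -- The coefficients `μ n` with `n > m` are unconstrained, and are replaced by zero.
  let β : ℕ → P →ₗ[K] P →ₗ[K] P := fun n => if hn : n ≤ m then (cochain n hn).toBilin else 0
  have hβ : ∀ n ≤ m, ∀ x y, β n x y = μ n x y := fun n hn x y => by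
    simp only [β, dif_pos hn]
    rfl
  have hb' : ∀ x y, b x y = extendBilin m β x y := by
    intro x y
    refine induction_const K (fun x => ?_) (fun x x' hx hx' => ?_) (fun c x hx => ?_) x
    · refine induction_const K (fun y => ?_) (fun y y' hy hy' => ?_) (fun c y hy => ?_) y
      · rw [hb, extendBilin_const, mk_eq_mk_iff]
        exact fun n hn => (hβ n hn x y).symm
      · exact ((h.linear_right _).map_add y y').trans (by rw [hy, hy', map_add])
      · exact ((h.linear_right _).map_smul c y).trans (by rw [hy, map_smul])
    · exact ((h.linear_left y).map_add x x').trans (by rw [hx, hx', map_add, LinearMap.add_apply])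
    · exact ((h.linear_left y).map_smul c x).trans (by rw [hx, map_smul, LinearMap.smul_apply])
  have hb_mk : ∀ x a, b (const m x) (mk m a) = mk m fun n =>
      ∑ p ∈ Finset.HasAntidiagonal.antidiagonal n, μ p.1 x (a p.2) := by
    intro x a
    rw [hb', extendBilin_const_left, mk_eq_mk_iff]
    exact fun n hn => Finset.sum_congr rfl fun p hp =>
      hβ _ ((Finset.HasAntidiagonal.antidiagonal.fst_le hp).trans hn) _ _
  refine ⟨cochain, fun n hn x y z => ?_, fun n hn x y => ?_⟩
  · have := h.jacobi h2' (const m x) (const m y) (const m z)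
    rw [hb, hb, hb, hb_mk, hb_mk, hb_mk, mk_add_mk, mk_add_mk] at this
    rw [Finset.sum_add_distrib, Finset.sum_add_distrib]
    exact (coeff_mk _ hn).symm.trans ((congrArg (coeff n) this).trans (coeff_zero n))
  · have := h.sq_jacobi (constOdd m x) (const m y)
    change b _ _ = b (const m (x : P)) (b (const m (x : P)) (const m y)) at this
    rw [hb, hq, symm, hb_mk, hb_mk] at this
    rw [Finset.sum_add_distrib, mk_eq_mk_iff.1 this n hn, h2]

end Deformation

/-! ### Construction of a deformation from its coefficients -/

theorem TruncatedSeries.isCompl_grading {K P : Type*} [CommRing K] [AddCommGroup P] [Module K P]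
    {𝒜 : ZMod 2 → Submodule K P} (h : IsCompl (𝒜 0) (𝒜 1))
    (m : ℕ) : IsCompl (grading m 𝒜 0) (grading m 𝒜 1) := by
  constructor
  · rw [Submodule.disjoint_def]
    intro x hx₀ hx₁
    exact ext_coeff fun n _ =>
      (Submodule.disjoint_def.1 h.disjoint _ (hx₀ n) (hx₁ n)).trans (coeff_zero n).symm
  · rw [codisjoint_iff, eq_top_iff]
    intro x _
    choose a ha b hb hab using h.exists_add_eq
    refine Submodule.mem_sup.2 ⟨mk m fun n => a (coeff n x), mk_mem_grading.2 fun n _ => ha _,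
      mk m fun n => b (coeff n x), mk_mem_grading.2 fun n _ => hb _, ext_coeff fun n hn => ?_⟩
    rw [coeff_add, coeff_mk _ hn, coeff_mk _ hn, hab]

namespace TruncatedSeries

section Extension

variable {K P : Type*} [CommRing K] {m : ℕ}

/-- A trilinear map on `P_m[[t]]` that vanishes on constants is zero. -/
theorem trilinear_eq_zero [AddCommGroup P] [Module K P]
    {F : TruncatedSeries m P → TruncatedSeries m P → TruncatedSeries m P → TruncatedSeries m P}
    (h₁ : ∀ y z, IsLinearMap K⟦X⟧ fun x => F x y z) (h₂ : ∀ x z, IsLinearMap K⟦X⟧ fun y => F x y z)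
    (h₃ : ∀ x y, IsLinearMap K⟦X⟧ fun z => F x y z)
    (h : ∀ x y z, F (const m x) (const m y) (const m z) = 0) (x y z : TruncatedSeries m P) :
    F x y z = 0 := by
  refine induction_const K (fun x => ?_) (fun x x' hx hx' => ?_) (fun c x hx => ?_) x
  · refine induction_const K (fun y => ?_) (fun y y' hy hy' => ?_) (fun c y hy => ?_) y
    · refine induction_const K (fun z => h x y z) (fun z z' hz hz' => ?_) (fun c z hz => ?_) z
      · exact ((h₃ _ _).map_add z z').trans (by rw [hz, hz', add_zero])
      · exact ((h₃ _ _).map_smul c z).trans (by rw [hz, smul_zero])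
    · exact ((h₂ _ _).map_add y y').trans (by rw [hy, hy', add_zero])
    · exact ((h₂ _ _).map_smul c y).trans (by rw [hy, smul_zero])
  · exact ((h₁ _ _).map_add x x').trans (by rw [hx, hx', add_zero])
  · exact ((h₁ _ _).map_smul c x).trans (by rw [hx, smul_zero])

/-- The Jacobi identity for a `K[[t]]`-bilinear map follows from the case of constants. -/
theorem jacobi_of_const [AddCommGroup P] [Module K P]
    (B : TruncatedSeries m P →ₗ[K⟦X⟧] TruncatedSeries m P →ₗ[K⟦X⟧] TruncatedSeries m P)
    (h : ∀ x y z, B (const m x) (B (const m y) (const m z)) +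
      B (const m y) (B (const m z) (const m x)) + B (const m z) (B (const m x) (const m y)) = 0)
    (x y z : TruncatedSeries m P) : B x (B y z) + B y (B z x) + B z (B x y) = 0 := by
  refine trilinear_eq_zero (K := K) (F := fun x y z => B x (B y z) + B y (B z x) + B z (B x y))
    (fun y z => ⟨fun x x' => ?_, fun c x => ?_⟩) (fun x z => ⟨fun y y' => ?_, fun c y => ?_⟩)
    (fun x y => ⟨fun z z' => ?_, fun c z => ?_⟩) h x y z
  all_goals simp only [map_add, map_smul, LinearMap.add_apply, LinearMap.smul_apply, smul_add]
  all_goals abel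

theorem leibniz_of_const [NonUnitalCommRing P] [Module K P] [IsScalarTower K P P]
    (B : TruncatedSeries m P →ₗ[K⟦X⟧] TruncatedSeries m P →ₗ[K⟦X⟧] TruncatedSeries m P)
    (h : ∀ x y z, B (const m x * const m y) (const m z) =
      const m x * B (const m y) (const m z) + B (const m x) (const m z) * const m y)
    (x y z : TruncatedSeries m P) : B (x * y) z = x * B y z + B x z * y := by
  refine sub_eq_zero.1 (trilinear_eq_zero (K := K)
    (F := fun x y z => B (x * y) z - (x * B y z + B x z * y))
    (fun y z => ⟨fun x x' => ?_, fun c x => ?_⟩) (fun x z => ⟨fun y y' => ?_, fun c y => ?_⟩)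
    (fun x y => ⟨fun z z' => ?_, fun c z => ?_⟩) (fun x y z => sub_eq_zero.2 (h x y z)) x y z)
  all_goals simp only [map_add, map_smul, LinearMap.add_apply, LinearMap.smul_apply, smul_add,
    smul_sub, mul_add, add_mul, smul_mul_assoc, mul_smul_comm]
  all_goals abel

theorem symm_of_const [AddCommGroup P] [Module K P]
    (B : TruncatedSeries m P →ₗ[K⟦X⟧] TruncatedSeries m P →ₗ[K⟦X⟧] TruncatedSeries m P)
    (h : ∀ x y, B (const m x) (const m y) = B (const m y) (const m x))
    (x y : TruncatedSeries m P) : B x y = B y x := by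
  refine induction_const K (fun x => ?_) (fun x x' hx hx' => ?_) (fun c x hx => ?_) x
  · refine induction_const K (fun y => h x y) (fun y y' hy hy' => ?_) (fun c y hy => ?_) y
    · rw [map_add, map_add, LinearMap.add_apply, hy, hy']
    · rw [map_smul, map_smul, LinearMap.smul_apply, hy]
  · rw [map_add, map_add, LinearMap.add_apply, hx, hx']
  · rw [map_smul, map_smul, LinearMap.smul_apply, hx]

/-- The compatibility of a squaring `y ↦ C y y` with the product follows from the case of
constants, because its two sides have the same polar form in `x` and in `y`. -/
theorem sq_mul_of_const [NonUnitalCommRing P] [Module K P] [IsScalarTower K P P]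
    (h2 : ∀ x : P, x + x = 0) {𝒜 : ZMod 2 → Submodule K P}
    (B C : TruncatedSeries m P →ₗ[K⟦X⟧] TruncatedSeries m P →ₗ[K⟦X⟧] TruncatedSeries m P)
    (symm : ∀ x y, B x y = B y x) (self : ∀ x, B x x = 0)
    (leibniz : ∀ x y z, B (x * y) z = x * B y z + B x z * y)
    (diag_add : ∀ x ∈ grading m 𝒜 1, ∀ y ∈ grading m 𝒜 1,
      C (x + y) (x + y) = C x x + C y y + B x y)
    (mem : ∀ x ∈ grading m 𝒜 0, ∀ y ∈ grading m 𝒜 1, x * y ∈ grading m 𝒜 1)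
    (mul_self : ∀ x ∈ grading m 𝒜 1, x * x = 0)
    (h : ∀ x ∈ 𝒜 0, ∀ y ∈ 𝒜 1, C (const m x * const m y) (const m x * const m y) =
      const m x * const m x * C (const m y) (const m y) +
        const m x * const m y * B (const m x) (const m y))
    {x y : TruncatedSeries m P} (hx : x ∈ grading m 𝒜 0) (hy : y ∈ grading m 𝒜 1) :
    C (x * y) (x * y) = x * x * C y y + x * y * B x y := by
  have h2' : ∀ x : TruncatedSeries m P, (x : Unitization ℤ (TruncatedSeries m P)) + x = 0 :=
    fun x => by rw [← Unitization.inr_add, TruncatedSeries.add_self h2, Unitization.inr_zero]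
  have diag_smul : ∀ (c : K⟦X⟧) x, C (c • x) (c • x) = c ^ 2 • C x x := fun c x => by
    rw [LinearMap.map_smul₂, map_smul, smul_smul, sq]
  have leibniz' : ∀ x y z, B x (y * z) = y * B x z + B x y * z := fun x y z => by
    rw [symm, leibniz, symm x, symm x]
  refine grading_induction (p := fun y => C (x * y) (x * y) = x * x * C y y + x * y * B x y)
    (fun y hy => ?_) (fun y hy y' hy' hy₁ hy₂ => ?_) (fun c y _ hy => ?_) hy
  · refine grading_induction (p := fun x => C (x * const m y) (x * const m y) =
        x * x * C (const m y) (const m y) + x * const m y * B x (const m y))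
      (fun x hx => h x hx y hy) (fun x hx x' hx' hx₁ hx₂ => ?_) (fun c x _ hx => ?_) hx
    · have hy' := const_mem_grading m 𝒜 hy
      have hyy := congrArg (Unitization.inr (R := ℤ)) (mul_self _ hy')
      rw [add_mul, diag_add _ (mem x hx _ hy') _ (mem x' hx' _ hy'), hx₁, hx₂, leibniz, leibniz',
        leibniz', self, map_add, LinearMap.add_apply, symm (const m y) x']
      -- The tactics for polynomial identities need a unit: pass to the unitization.
      apply Unitization.inr_injective (R := ℤ)
      simp only [Unitization.inr_add, Unitization.inr_mul, Unitization.inr_zero] at hyy ⊢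
      grind
    · rw [smul_mul_assoc, diag_smul, hx, map_smul, LinearMap.smul_apply, smul_mul_assoc,
        mul_smul_comm, smul_smul, smul_mul_assoc, smul_mul_assoc, mul_smul_comm, smul_smul,
        smul_add, ← sq]
  · rw [mul_add, diag_add _ (mem x hx _ hy) _ (mem x hx _ hy'), hy₁, hy₂,
      diag_add _ hy _ hy', map_add, leibniz, leibniz', leibniz', self, symm y x]
    apply Unitization.inr_injective (R := ℤ)
    simp only [Unitization.inr_add, Unitization.inr_mul, Unitization.inr_zero]
    grind
  · rw [mul_smul_comm, diag_smul, hy, diag_smul, map_smul, mul_smul_comm, smul_mul_assoc,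
      mul_smul_comm, smul_smul, smul_add, sq]

end Extension

end TruncatedSeries

open TruncatedSeries in
/-- A Poisson superalgebra structure on `P_m[[t]]` with prescribed coefficients.  The bracket is the
bilinear extension of the brackets `μ_n`.  The squaring is the diagonal of the bilinear extension of
bilinear maps `γ_n` with `γ_n(x, x) = ω_n(x)` for `x` odd, so that it is quadratic by construction.
All identities are then checked on constants. -/
theorem exists_isPoissonSuperalgebra_of_isTruncatedPoisson {K P : Type*} [Field K]
    [NonUnitalCommRing P] [Module K P] [IsScalarTower K P P] (h2 : ∀ x : P, x + x = 0)
    {𝒜 : ZMod 2 → Submodule K P} {m : ℕ} {μ : ℕ → P → P → P} {ω : ℕ → 𝒜 1 → P}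
    (h : IsTruncatedPoisson 𝒜 m μ ω) (hc : IsCompl (𝒜 0) (𝒜 1))
    (mul_mem : ∀ i j, ∀ x ∈ 𝒜 i, ∀ y ∈ 𝒜 j, x * y ∈ 𝒜 (i + j))
    (mul_self_odd : ∀ x ∈ 𝒜 1, x * x = 0) :
    ∃ (b : TruncatedSeries m P → TruncatedSeries m P → TruncatedSeries m P)
      (q : grading m 𝒜 1 → TruncatedSeries m P),
      IsPoissonSuperalgebra K⟦X⟧ (grading m 𝒜) b q ∧
      (∀ x y, b (const m x) (const m y) = mk m fun i => μ i x y) ∧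
      (∀ z : 𝒜 1, q (constOdd m z) = mk m fun i => ω i z) := by
  have h2' := TruncatedSeries.add_self h2 (k := m)
  let β : ℕ → P →ₗ[K] P →ₗ[K] P := fun n => if hn : n ≤ m then (h.cochain n hn).toBilin else 0
  have hβ : ∀ n ≤ m, ∀ x y, β n x y = μ n x y := fun n hn x y => by
    simp only [β, dif_pos hn]
    rfl
  have hγ : ∀ n, ∃ γ : P →ₗ[K] P →ₗ[K] P, n ≤ m → ∀ x : 𝒜 1, γ x x = ω n x := fun n => by
    by_cases hn : n ≤ m
    · obtain ⟨γ, hγ⟩ := (h.cochain n hn).exists_bilin hc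
      exact ⟨γ, fun _ => hγ⟩
    · exact ⟨0, fun h => absurd h hn⟩
  choose γ hγ using hγ
  -- Only the values on constants matter from here on.
  obtain ⟨B, hB, hB_mk⟩ :
      ∃ B : TruncatedSeries m P →ₗ[K⟦X⟧] TruncatedSeries m P →ₗ[K⟦X⟧] TruncatedSeries m P,
        (∀ x y, B (const m x) (const m y) = mk m fun i => μ i x y) ∧
        ∀ x a, B (const m x) (mk m a) = mk m fun n =>
          ∑ p ∈ Finset.HasAntidiagonal.antidiagonal n, μ p.1 x (a p.2) := by
    refine ⟨extendBilin m β, fun x y => ?_, fun x a => ?_⟩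
    · rw [extendBilin_const, mk_eq_mk_iff]
      exact fun n hn => hβ n hn x y
    · rw [extendBilin_const_left, mk_eq_mk_iff]
      exact fun n hn => Finset.sum_congr rfl fun p hp =>
        hβ _ ((Finset.HasAntidiagonal.antidiagonal.fst_le hp).trans hn) _ _
  obtain ⟨C, hC'⟩ :
      ∃ C : TruncatedSeries m P →ₗ[K⟦X⟧] TruncatedSeries m P →ₗ[K⟦X⟧] TruncatedSeries m P,
        ∀ x y, C (const m x) (const m y) = mk m fun i => γ i x y :=
    ⟨extendBilin m γ, extendBilin_const γ⟩
  have hC : ∀ z (hz : z ∈ 𝒜 1), C (const m z) (const m z) = mk m fun i => ω i ⟨z, hz⟩ :=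
    fun z hz => by
      rw [hC', mk_eq_mk_iff]
      exact fun n hn => hγ n hn ⟨z, hz⟩
  have add_left : ∀ x y z, B (x + y) z = B x z + B y z := fun x y z => by
    rw [map_add, LinearMap.add_apply]
  have smul_left : ∀ (c : K⟦X⟧) x y, B (c • x) y = c • B x y := fun c x y => by
    rw [map_smul, LinearMap.smul_apply]
  have symm : ∀ x y, B x y = B y x := symm_of_const B fun x y => by
    rw [hB, hB, mk_eq_mk_iff]
    exact fun n hn => (h.cochain n hn).symm h2 x y
  have self : ∀ x, B x x = 0 := by
    intro x
    refine induction_const K (fun x => ?_) (fun x x' hx hx' => ?_) (fun c x hx => ?_) x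
    · rw [hB]
      exact ext_coeff fun n hn => by
        rw [coeff_mk _ hn, (h.cochain n hn).alternating, coeff_zero]
    · rw [map_add, add_left, add_left, hx, hx', symm x' x, zero_add, add_zero, h2']
    · rw [map_smul, smul_left, hx, smul_zero, smul_zero]
  have leibniz : ∀ x y z, B (x * y) z = x * B y z + B x z * y := leibniz_of_const B fun x y z => by
    rw [← const_mul, hB, hB, hB, mul_comm _ (const m y), const_mul_mk, const_mul_mk,
      mk_add_mk, mk_eq_mk_iff]
    exact fun n hn => (h.cochain n hn).derivation x y z
  have jacobi : ∀ x y z, B x (B y z) + B y (B z x) + B z (B x y) = 0 :=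
    jacobi_of_const B fun x y z => by
      rw [hB, hB, hB, hB_mk, hB_mk, hB_mk, mk_add_mk, mk_add_mk]
      refine ext_coeff fun n hn => ?_
      rw [coeff_mk _ hn, coeff_zero, ← Finset.sum_add_distrib, ← Finset.sum_add_distrib]
      exact h.jacobi n hn x y z
  -- On odd elements, the polar form of the diagonal of `C` is `B`.
  have polar : ∀ x ∈ grading m 𝒜 1, ∀ y ∈ grading m 𝒜 1, C x y + C y x = B x y := by
    intro x hx y hy
    refine grading_induction (p := fun x => C x y + C y x = B x y)
      (fun x hx => ?_) (fun x _ x' _ hx hx' => ?_) (fun c x _ hx => ?_) hx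
    · refine grading_induction (p := fun y => C (const m x) y + C y (const m x) = B (const m x) y)
        (fun y hy => ?_) (fun y _ y' _ hy hy' => ?_)
        (fun c y _ hy => ?_) hy
      · rw [hC', hC', hB, mk_add_mk, mk_eq_mk_iff]
        intro n hn
        have e := (h.cochain n hn).add ⟨x, hx⟩ ⟨y, hy⟩
        rw [← hγ n hn, ← hγ n hn, ← hγ n hn] at e
        simp only [Submodule.coe_add, map_add, LinearMap.add_apply] at e
        grind
      · rw [map_add, map_add, map_add, LinearMap.add_apply, ← hy, ← hy']
        abel
      · rw [map_smul, map_smul, map_smul, LinearMap.smul_apply, ← hy, smul_add]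
    · rw [add_left, map_add, map_add, LinearMap.add_apply, ← hx, ← hx']
      abel
    · rw [smul_left, map_smul, map_smul, LinearMap.smul_apply, ← hx, smul_add]
  have diag_add : ∀ x ∈ grading m 𝒜 1, ∀ y ∈ grading m 𝒜 1,
      C (x + y) (x + y) = C x x + C y y + B x y := by
    intro x hx y hy
    rw [← polar x hx y hy, LinearMap.map_add₂, map_add, map_add]
    abel
  have diag_smul : ∀ (c : K⟦X⟧) x, C (c • x) (c • x) = c ^ 2 • C x x := fun c x => by
    rw [LinearMap.map_smul₂, map_smul, smul_smul, sq]
  have bracket_mem : ∀ i j, ∀ x ∈ grading m 𝒜 i, ∀ y ∈ grading m 𝒜 j,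
      B x y ∈ grading m 𝒜 (i + j) := by
    intro i j x hx y hy
    refine grading_induction (p := fun x => B x y ∈ grading m 𝒜 (i + j))
      (fun x hx => ?_) (fun x _ x' _ hx hx' => ?_) (fun c x _ hx => ?_) hx
    · refine grading_induction (p := fun y => B (const m x) y ∈ grading m 𝒜 (i + j))
        (fun y hy => ?_) (fun y _ y' _ hy hy' => ?_)
        (fun c y _ hy => ?_) hy
      · rw [hB, mk_mem_grading]
        exact fun n hn => (h.cochain n hn).even_fst i j x hx y hy
      · rw [map_add]
        exact add_mem hy hy'
      · rw [map_smul]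
        exact Submodule.smul_mem _ _ hy
    · rw [add_left]
      exact add_mem hx hx'
    · rw [smul_left]
      exact Submodule.smul_mem _ _ hx
  have mul_mem' : ∀ i j, ∀ x ∈ grading m 𝒜 i, ∀ y ∈ grading m 𝒜 j,
      x * y ∈ grading m 𝒜 (i + j) := by
    intro i j x hx y hy n
    by_cases hn : n ≤ m
    · rw [coeff_mul hn]
      exact sum_mem fun p _ => mul_mem i j _ (hx _) _ (hy _)
    · rw [coeff_eq_zero _ (not_le.1 hn)]
      exact zero_mem _
  have mul_self : ∀ x ∈ grading m 𝒜 1, x * x = 0 := by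
    intro x hx
    refine grading_induction (p := fun x => x * x = 0)
      (fun x hx => ?_) (fun x _ y _ hx hy => ?_) (fun c x _ hx => ?_) hx
    · rw [← const_mul, mul_self_odd x hx]
      exact ext_coeff fun n hn => by rw [coeff_const _ hn, coeff_zero, ite_self]
    · rw [mul_add, add_mul, add_mul, hx, hy, mul_comm y x, zero_add, add_zero, h2']
    · rw [smul_mul_assoc, mul_smul_comm, hx, smul_zero, smul_zero]
  have even_add_odd : (0 + 1 : ZMod 2) = 1 := by decide
  have sq_mul : ∀ x ∈ grading m 𝒜 0, ∀ y ∈ grading m 𝒜 1,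
      C (x * y) (x * y) = x * x * C y y + x * y * B x y := fun x hx y hy => by
    refine sq_mul_of_const h2 B C symm self leibniz diag_add
      (fun x hx y hy => even_add_odd ▸ mul_mem' 0 1 x hx y hy) mul_self (fun x hx y hy => ?_) hx hy
    have hxy := even_add_odd ▸ mul_mem 0 1 x hx y hy
    rw [← const_mul, ← const_mul, hB, hC _ hxy, hC y hy, const_mul_mk, const_mul_mk,
      mk_add_mk, mk_eq_mk_iff]
    intro n hn
    rw [(h.cochain n hn).mul ⟨y, hy⟩ x hx ⟨x * y, hxy⟩ (mul_comm x y),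
      (h.cochain n hn).symm h2 x y, mul_comm x y]
  refine ⟨fun x y => B x y, fun x => C x x, ?_, hB, fun z => hC z z.2⟩
  exact
  { isCompl := isCompl_grading hc m
    linear_left := fun y => ⟨fun x x' => add_left x x' y, fun c x => smul_left c x y⟩
    linear_right := fun x => (B x).isLinear
    bracket_mem := bracket_mem
    even_self := fun x _ => self x
    even_jacobi := fun x _ y _ z _ => jacobi x y z
    odd_module := fun x _ y _ z _ => by
      have e := jacobi x y z
      rw [symm z (B x y), symm z x] at e
      rw [sub_eq_add_neg, neg_eq_of_add_eq_zero_left (h2' _)]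
      exact ((add_eq_zero_iff_eq_of_add_self h2').1 e).symm
    odd_symm := fun x _ y _ => symm y x
    sq_mem := fun x => by
      refine grading_induction (p := fun x => C x x ∈ grading m 𝒜 0) (fun x hx => ?_)
        (fun x hx y hy hx' hy' => ?_) (fun c x _ hx => ?_) x.2
      · rw [hC x hx, mk_mem_grading]
        exact fun n hn => (h.cochain n hn).even_snd _
      · rw [diag_add x hx y hy]
        refine add_mem (add_mem hx' hy') ?_
        exact (show (1 + 1 : ZMod 2) = 0 by decide) ▸ bracket_mem 1 1 x hx y hy
      · rw [diag_smul]
        exact Submodule.smul_mem _ _ hx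
    sq_smul := fun c x => diag_smul c x
    sq_polar := fun x y => by
      rw [Submodule.coe_add, diag_add x x.2 y y.2]
      abel
    sq_jacobi := fun x y => by
      refine grading_induction (p := fun x => B (C x x) y = B x (B x y)) (fun x hx => ?_)
        (fun x hx x' hx' e e' => ?_) (fun c x _ hx => ?_) x.2
      · refine induction_const K (fun y => ?_) (fun y y' hy hy' => ?_) (fun c y hy => ?_) y
        · rw [hC x hx, symm, hB, hB_mk, hB_mk, mk_eq_mk_iff]
          intro n hn
          have e := h.sq_jacobi n hn ⟨x, hx⟩ y
          rw [Finset.sum_add_distrib] at e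
          exact (add_eq_zero_iff_eq_of_add_self h2).1 e
        · rw [map_add, map_add, map_add, hy, hy']
        · rw [map_smul, map_smul, map_smul, hy]
      · -- The failure of the identity is additive because its polarization is the Jacobi identity.
        have j := jacobi x x' y
        rw [symm y x, symm y (B x x')] at j
        rw [diag_add x hx x' hx', add_left, add_left, e, e',
          ← (add_eq_zero_iff_eq_of_add_self h2').1 j]
        simp only [map_add, LinearMap.add_apply]
        abel
      · rw [diag_smul, smul_left, hx, smul_left, smul_left, map_smul, smul_smul, sq]
    mul_mem := mul_mem'
    mul_self_odd := mul_self
    leibniz := leibniz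
    sq_mul := fun x hx y w hw => by
      rw [hw]
      exact sq_mul x hx y y.2 }

/-! ### The obstruction is a cochain -/

section Composition

variable {K P : Type*} [Field K] [NonUnitalCommRing P] [Module K P]
  {𝒜 : ZMod 2 → Submodule K P} {φ ψ : P → P → P} {ω η : 𝒜 1 → P}

theorem IsEvenPoissonCochain₂.derivation_right (h : IsEvenPoissonCochain₂ 𝒜 φ ω)
    (h2 : ∀ x : P, x + x = 0) (x y z : P) : φ z (x * y) = x * φ z y + y * φ z x := by
  rw [h.symm h2, h.derivation, h.symm h2 y, h.symm h2 x]

/-- A composition of two biderivations fails to be a derivation by a term symmetric in the two. -/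
theorem IsEvenPoissonCochain₂.comp_derivation (h : IsEvenPoissonCochain₂ 𝒜 φ ω)
    (h' : IsEvenPoissonCochain₂ 𝒜 ψ η) (h2 : ∀ x : P, x + x = 0) (x y z v : P) :
    φ (x * y) (ψ z v) + φ z (ψ v (x * y)) + φ v (ψ (x * y) z) =
      x * (φ y (ψ z v) + φ z (ψ v y) + φ v (ψ y z)) +
      y * (φ x (ψ z v) + φ z (ψ v x) + φ v (ψ x z)) +
      ((φ z x * ψ v y + φ z y * ψ v x) + (ψ z x * φ v y + ψ z y * φ v x)) := by
  rw [h.derivation, h'.derivation, h'.derivation_right h2, (h.linear₂ _).map_add,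
    (h.linear₂ _).map_add, h.derivation_right h2, h.derivation_right h2, h.derivation_right h2,
    h.derivation_right h2, h'.symm h2 y z, h'.symm h2 x z]
  -- The tactics for polynomial identities need a unit: pass to the unitization of `P`.
  apply Unitization.inr_injective (R := ℤ)
  simp only [Unitization.inr_add, Unitization.inr_mul]
  ring

/-- The analogue of `comp_derivation` for the second component of the obstruction, where `x * x = 0`
is needed. -/
theorem IsEvenPoissonCochain₂.sq_comp_mul (h : IsEvenPoissonCochain₂ 𝒜 φ ω)
    (h' : IsEvenPoissonCochain₂ 𝒜 ψ η) (h2 : ∀ x : P, x + x = 0)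
    (mul_self_odd : ∀ x ∈ 𝒜 1, x * x = 0) (x : 𝒜 1) {y : P} (hy : y ∈ 𝒜 0) (w : 𝒜 1)
    (hw : (w : P) = x * y) (z : P) :
    φ z (η w) + φ w (ψ w z) =
      y * y * (φ z (η x) + φ x (ψ x z)) +
      x * y * (φ x (ψ y z) + φ y (ψ z x) + φ z (ψ x y)) +
      ((x * φ x y * ψ y z + y * φ x y * ψ x z) + (x * ψ x y * φ y z + y * ψ x y * φ x z)) := by
  have hx := congrArg (Unitization.inr (R := ℤ)) (mul_self_odd x x.2)
  have h2' : ∀ x : P, (x : Unitization ℤ P) + x = 0 :=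
    fun x => by rw [← Unitization.inr_add, h2, Unitization.inr_zero]
  rw [h'.mul x y hy w hw, hw, h'.derivation, h.derivation, (h.linear₂ _).map_add,
    (h.linear₂ _).map_add, (h.linear₂ _).map_add]
  simp only [h.derivation_right h2, h.alternating]
  rw [h'.symm h2 z x, h.symm h2 z y, h.symm h2 z x, h.symm h2 y x]
  generalize (x : P) = x at *
  apply Unitization.inr_injective (R := ℤ)
  simp only [Unitization.inr_add, Unitization.inr_mul, Unitization.inr_zero] at hx ⊢
  clear h h' hw
  grind

theorem IsEvenPoissonCochain₂.sq_comp_mul_right (h : IsEvenPoissonCochain₂ 𝒜 φ ω)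
    (h' : IsEvenPoissonCochain₂ 𝒜 ψ η) (h2 : ∀ x : P, x + x = 0) (x : 𝒜 1) (z v : P) :
    φ (z * v) (η x) + φ x (ψ x (z * v)) =
      z * (φ v (η x) + φ x (ψ x v)) + v * (φ z (η x) + φ x (ψ x z)) +
      (φ x z * ψ x v + ψ x z * φ x v) := by
  rw [h.derivation, h'.derivation_right h2, (h.linear₂ _).map_add, h.derivation_right h2,
    h.derivation_right h2]
  apply Unitization.inr_injective (R := ℤ)
  simp only [Unitization.inr_add, Unitization.inr_mul]
  ring

end Composition

theorem sum_Icc_swap {P : Type*} [AddCommMonoid P] (k : ℕ) (D : ℕ → ℕ → P) :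
    ∑ i ∈ Finset.Icc 1 k, D (k + 1 - i) i = ∑ i ∈ Finset.Icc 1 k, D i (k + 1 - i) := by
  refine Finset.sum_nbij' (fun i => k + 1 - i) (fun i => k + 1 - i) ?_ ?_ ?_ ?_ ?_
  all_goals
    intro i hi
    rw [Finset.mem_Icc] at hi
  · exact Finset.mem_Icc.2 (by omega)
  · exact Finset.mem_Icc.2 (by omega)
  · omega
  · omega
  · rw [Nat.sub_sub_self (by omega)]

/-- Terms symmetric in the two indices cancel in characteristic 2. -/
theorem sum_Icc_add_swap_eq_zero {P : Type*} [AddCommGroup P] (h2 : ∀ x : P, x + x = 0) (k : ℕ)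
    (D : ℕ → ℕ → P) : ∑ i ∈ Finset.Icc 1 k, (D i (k + 1 - i) + D (k + 1 - i) i) = 0 := by
  rw [Finset.sum_add_distrib, sum_Icc_swap, h2]

/-- The obstruction is an even Poisson 3-cochain.  The Jacobi identities are not needed for this,
only that its terms are composed of even Poisson 2-cochains. -/
theorem isEvenPoissonCochain₃_obs {K P : Type*} [Field K] [NonUnitalCommRing P] [Module K P]
    {𝒜 : ZMod 2 → Submodule K P} {k : ℕ} {μ : ℕ → P → P → P} {ω : ℕ → 𝒜 1 → P}
    (h2 : ∀ x : P, x + x = 0) (mul_self_odd : ∀ x ∈ 𝒜 1, x * x = 0)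
    (h : ∀ n ≤ k, IsEvenPoissonCochain₂ 𝒜 (μ n) (ω n)) :
    IsEvenPoissonCochain₃ 𝒜 (obs₁ k μ) (obs₂ k μ ω) := by
  have h₁ : ∀ i ∈ Finset.Icc 1 k, IsEvenPoissonCochain₂ 𝒜 (μ i) (ω i) :=
    fun i hi => h i (Finset.mem_Icc.1 hi).2
  have h₂ : ∀ i ∈ Finset.Icc 1 k, IsEvenPoissonCochain₂ 𝒜 (μ (k + 1 - i)) (ω (k + 1 - i)) :=
    fun i hi => h _ (by have := (Finset.mem_Icc.1 hi).1; omega)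
  have cyclic : ∀ x y z, obs₁ k μ x y z = obs₁ k μ y z x := fun x y z =>
    Finset.sum_congr rfl fun i _ => by abel
  have linear₁ : ∀ y z, IsLinearMap K (fun x => obs₁ k μ x y z) := fun y z =>
    { map_add := fun x x' => by
        rw [obs₁, obs₁, obs₁, ← Finset.sum_add_distrib]
        refine Finset.sum_congr rfl fun i hi => ?_
        rw [((h₁ i hi).linear₁ _).map_add, ((h₂ i hi).linear₁ _).map_add,
          ((h₂ i hi).linear₂ _).map_add, ((h₁ i hi).linear₂ _).map_add,
          ((h₁ i hi).linear₂ _).map_add]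
        abel
      map_smul := fun c x => by
        rw [obs₁, obs₁, Finset.smul_sum]
        refine Finset.sum_congr rfl fun i hi => ?_
        rw [((h₁ i hi).linear₁ _).map_smul, ((h₂ i hi).linear₁ _).map_smul,
          ((h₂ i hi).linear₂ _).map_smul, ((h₁ i hi).linear₂ _).map_smul,
          ((h₁ i hi).linear₂ _).map_smul, smul_add, smul_add] }
  have alternating : ∀ x z, obs₁ k μ x x z = 0 := fun x z =>
    Finset.sum_eq_zero fun i hi => by
      rw [(h₂ i hi).symm h2 z x, (h₂ i hi).alternating, h2, zero_add]
      exact ((h₁ i hi).linear₂ z).map_zero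
  exact
  { linear₁ := linear₁
    linear₂ := fun x z => by simpa only [cyclic x] using linear₁ z x
    linear₃ := fun x y => by simpa only [← cyclic _ x y] using linear₁ x y
    alternating₁₂ := alternating
    alternating₁₃ := fun x y => by rw [← cyclic, alternating]
    alternating₂₃ := fun x y => by rw [cyclic, alternating]
    smul := fun c x z => by
      rw [obs₂, obs₂, Finset.smul_sum]
      refine Finset.sum_congr rfl fun i hi => ?_
      rw [(h₂ i hi).smul, Submodule.coe_smul, ((h₁ i hi).linear₂ _).map_smul,
        ((h₁ i hi).linear₁ _).map_smul, ((h₂ i hi).linear₁ _).map_smul,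
        ((h₁ i hi).linear₂ _).map_smul, smul_smul, smul_add, sq]
    add := fun x y z => by
      rw [obs₂, obs₂, obs₂, obs₁, ← Finset.sum_add_distrib, ← Finset.sum_add_distrib]
      refine Finset.sum_congr rfl fun i hi => ?_
      rw [(h₂ i hi).add, Submodule.coe_add, ((h₁ i hi).linear₂ _).map_add,
        ((h₁ i hi).linear₂ _).map_add, ((h₁ i hi).linear₁ _).map_add,
        ((h₂ i hi).linear₁ _).map_add, ((h₁ i hi).linear₂ _).map_add,
        ((h₁ i hi).linear₂ _).map_add, (h₂ i hi).symm h2 z x]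
      abel
    linear := fun x =>
      { map_add := fun z z' => by
          rw [obs₂, obs₂, obs₂, ← Finset.sum_add_distrib]
          refine Finset.sum_congr rfl fun i hi => ?_
          rw [((h₁ i hi).linear₁ _).map_add, ((h₂ i hi).linear₂ _).map_add,
            ((h₁ i hi).linear₂ _).map_add]
          abel
        map_smul := fun c z => by
          rw [obs₂, obs₂, Finset.smul_sum]
          refine Finset.sum_congr rfl fun i hi => ?_
          rw [((h₁ i hi).linear₁ _).map_smul, ((h₂ i hi).linear₂ _).map_smul,
            ((h₁ i hi).linear₂ _).map_smul, smul_add] }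
    derivation := fun x y z v => by
      rw [obs₁, Finset.sum_congr rfl fun i hi =>
          (h₁ i hi).comp_derivation (h₂ i hi) h2 x y z v, Finset.sum_add_distrib,
        Finset.sum_add_distrib, ← Finset.mul_sum, ← Finset.mul_sum,
        sum_Icc_add_swap_eq_zero h2 k fun i j => μ i z x * μ j v y + μ i z y * μ j v x, add_zero]
      rfl
    mul := fun x y hy w hw z => by
      rw [obs₂, Finset.sum_congr rfl fun i hi =>
          (h₁ i hi).sq_comp_mul (h₂ i hi) h2 mul_self_odd x hy w hw z, Finset.sum_add_distrib,
        Finset.sum_add_distrib, ← Finset.mul_sum, ← Finset.mul_sum,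
        sum_Icc_add_swap_eq_zero h2 k fun i j =>
          x * μ i x y * μ j y z + y * μ i x y * μ j x z, add_zero]
      rfl
    mul_right := fun x z v => by
      rw [obs₂, Finset.sum_congr rfl fun i hi =>
          (h₁ i hi).sq_comp_mul_right (h₂ i hi) h2 x z v, Finset.sum_add_distrib,
        Finset.sum_add_distrib, ← Finset.mul_sum, ← Finset.mul_sum,
        sum_Icc_add_swap_eq_zero h2 k fun i j => μ i x z * μ j x v, add_zero]
      rfl
    even_fst := fun i j l x hx y hy z hz => by
      refine sum_mem fun n hn => add_mem (add_mem ?_ ?_) ?_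
      · rw [add_assoc]
        exact (h₁ n hn).even_fst _ _ x hx _ ((h₂ n hn).even_fst _ _ y hy z hz)
      · rw [show i + j + l = j + (l + i) by ring]
        exact (h₁ n hn).even_fst _ _ y hy _ ((h₂ n hn).even_fst _ _ z hz x hx)
      · rw [show i + j + l = l + (i + j) by ring]
        exact (h₁ n hn).even_fst _ _ z hz _ ((h₂ n hn).even_fst _ _ x hx y hy)
    even_snd := fun i x z hz => by
      refine sum_mem fun n hn => add_mem ?_ ?_
      · have := (h₁ n hn).even_fst _ _ z hz _ ((h₂ n hn).even_snd x)
        rwa [add_zero] at this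
      · have := (h₁ n hn).even_fst _ _ x x.2 _ ((h₂ n hn).even_fst _ _ x x.2 z hz)
        rwa [← add_assoc, show (1 + 1 : ZMod 2) = 0 by decide, zero_add] at this }

/-! ### Extension of deformations -/

/-- A deformation of order `m` amounts to the conditions of `IsTruncatedPoisson` on its
coefficients. -/
theorem isDeformationOfOrder_iff {K P : Type*} [Field K] [CharP K 2] [NonUnitalCommRing P]
    [Module K P] [IsScalarTower K P P] [SMulCommClass K P P] {𝒜 : ZMod 2 → Submodule K P}
    {br : P → P → P} {s : 𝒜 1 → P} (hP : IsPoissonSuperalgebra K 𝒜 br s) (m : ℕ)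
    (μ : ℕ → P → P → P) (ω : ℕ → 𝒜 1 → P) :
    IsDeformationOfOrder 𝒜 br s m μ ω ↔ μ 0 = br ∧ ω 0 = s ∧ IsTruncatedPoisson 𝒜 m μ ω := by
  have h2 := add_self_eq_zero_of_charP_two K (P := P)
  refine and_congr_right fun _ => and_congr_right fun _ => ⟨?_, fun h =>
    exists_isPoissonSuperalgebra_of_isTruncatedPoisson h2 h hP.isCompl hP.mul_mem hP.mul_self_odd⟩
  rintro ⟨b, q, h, hb, hq⟩
  exact isTruncatedPoisson_of_isPoissonSuperalgebra h2 h hb hq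

theorem sum_antidiagonal_succ_eq_sum_Icc {P : Type*} [AddCommMonoid P] (k : ℕ) (f : ℕ → ℕ → P) :
    ∑ p ∈ Finset.HasAntidiagonal.antidiagonal (k + 1), f p.1 p.2 =
      ∑ i ∈ Finset.Icc 1 k, f i (k + 1 - i) + (f 0 (k + 1) + f (k + 1) 0) := by
  rw [Finset.Nat.sum_antidiagonal_eq_sum_range_succ f, Finset.sum_range_succ,
    Finset.sum_range_succ', Nat.sub_self, Nat.sub_zero, add_assoc, Finset.range_eq_Ico,
    Finset.sum_Ico_add' (fun i => f i (k + 1 - i)), zero_add, Finset.Ico_add_one_right_eq_Icc]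

/-- Going from order `k` to order `k + 1` adds only the Jacobi identities in degree `k + 1`, whose
left-hand sides are the sum of the obstruction and of a coboundary. -/
theorem isTruncatedPoisson_succ_iff {K P : Type*} [Field K] [NonUnitalCommRing P] [Module K P]
    (h2 : ∀ x : P, x + x = 0) {𝒜 : ZMod 2 → Submodule K P} {k : ℕ} {μ : ℕ → P → P → P}
    {ω : ℕ → 𝒜 1 → P} (h : IsTruncatedPoisson 𝒜 k μ ω)
    (h' : IsEvenPoissonCochain₂ 𝒜 (μ (k + 1)) (ω (k + 1))) :
    IsTruncatedPoisson 𝒜 (k + 1) μ ω ↔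
      (obs₁ k μ, obs₂ k μ ω) = poissonD₂ (μ 0) (ω 0) (μ (k + 1)) (ω (k + 1)) := by
  have h₀ := h.cochain 0 (Nat.zero_le k)
  have e₁ : ∀ x y z, ∑ p ∈ Finset.HasAntidiagonal.antidiagonal (k + 1),
      (μ p.1 x (μ p.2 y z) + μ p.1 y (μ p.2 z x) + μ p.1 z (μ p.2 x y)) =
      obs₁ k μ x y z + (poissonD₂ (μ 0) (ω 0) (μ (k + 1)) (ω (k + 1))).1 x y z := fun x y z => by
    rw [sum_antidiagonal_succ_eq_sum_Icc k fun i j =>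
      μ i x (μ j y z) + μ i y (μ j z x) + μ i z (μ j x y)]
    simp only [obs₁, poissonD₂]
    rw [h'.symm h2 z x, h'.symm h2 x (μ 0 y z), h'.symm h2 y (μ 0 z x),
      h'.symm h2 z (μ 0 x y), h₀.symm h2 z x]
    abel
  have e₂ : ∀ (x : 𝒜 1) y, ∑ p ∈ Finset.HasAntidiagonal.antidiagonal (k + 1),
      (μ p.1 y (ω p.2 x) + μ p.1 x (μ p.2 x y)) =
      obs₂ k μ ω x y + (poissonD₂ (μ 0) (ω 0) (μ (k + 1)) (ω (k + 1))).2 x y := fun x y => by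
    rw [sum_antidiagonal_succ_eq_sum_Icc k fun i j => μ i y (ω j x) + μ i x (μ j x y)]
    simp only [obs₂, poissonD₂]
    rw [h'.symm h2 y, h'.symm h2 x (μ 0 x y)]
    abel
  constructor
  · intro H
    refine Prod.ext (funext fun x => funext fun y => funext fun z => ?_)
      (funext fun x => funext fun y => ?_)
    · exact (add_eq_zero_iff_eq_of_add_self h2).1 ((e₁ x y z).symm.trans (H.jacobi _ le_rfl x y z))
    · exact (add_eq_zero_iff_eq_of_add_self h2).1 ((e₂ x y).symm.trans (H.sq_jacobi _ le_rfl x y))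
  · intro H
    refine ⟨fun n hn => ?_, fun n hn x y z => ?_, fun n hn x y => ?_⟩
    all_goals rcases Nat.le_succ_iff.1 hn with hn | rfl
    · exact h.cochain n hn
    · exact h'
    · exact h.jacobi n hn x y z
    · rw [Nat.succ_eq_add_one, e₁, ← H, h2]
    · exact h.sq_jacobi n hn x y
    · rw [Nat.succ_eq_add_one, e₂, ← H, h2]

theorem mainTheorem6 {K P : Type*} [Field K] [CharP K 2] [NonUnitalCommRing P] [Module K P]
    [IsScalarTower K P P] [SMulCommClass K P P]
    (𝒜 : ZMod 2 → Submodule K P) (br : P → P → P) (s : 𝒜 1 → P)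
    (hP : IsPoissonSuperalgebra K 𝒜 br s)
    (k : ℕ) (hk : 1 ≤ k) (μ : ℕ → P → P → P) (ω : ℕ → 𝒜 1 → P)
    (hdef : IsDeformationOfOrder 𝒜 br s k μ ω) :
    IsEvenPoissonCochain₃ 𝒜 (obs₁ k μ) (obs₂ k μ ω) ∧
    (IsEvenPoissonCochain₂ 𝒜 (μ (k + 1)) (ω (k + 1)) →
      (IsDeformationOfOrder 𝒜 br s (k + 1) μ ω ↔
        (obs₁ k μ, obs₂ k μ ω) = poissonD₂ br s (μ (k + 1)) (ω (k + 1)))) := by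
  have h2 := add_self_eq_zero_of_charP_two K (P := P)
  obtain ⟨rfl, rfl, h⟩ := (isDeformationOfOrder_iff hP k μ ω).1 hdef
  refine ⟨isEvenPoissonCochain₃_obs h2 hP.mul_self_odd h.cochain, fun h' => ?_⟩
  rw [isDeformationOfOrder_iff hP, ← isTruncatedPoisson_succ_iff h2 h h']
  exact ⟨fun H => H.2.2, fun H => ⟨rfl, rfl, H⟩⟩
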